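/- Let $\mathcal M$ be a diffuse von Neumann algebra with a normal tracial state $\tau$, let $\mathcal N\subseteq\mathcal M$ be a diffuse (unital) von Neumann subalgebra, and let $u\in\mathcal M$ be a unitary such that $\mathcal N\cup\{u\}$ generates $\mathcal M$ as a von Neumann algebra. Assume that $\mathcal N$ is finitely generated and $\mathfrak K_2(\mathcal N)=0$ (with respect to $\tau|_{\mathcal N}$). If there are sequences $(v_n)$, $(w_n)$ of Haar unitaries in $\mathcal N$ with $\|v_nu-uw_n\|_2\to0$, then $\mathcal M$ is finitely generated and $\mathfrak K_2(\mathcal M)=0$. In particular, if there are Haar unitaries $v,w\in\mathcal N$ with $vu=uw$, then $\mathcal M$ is finitely generated and $\mathfrak K_2(\mathcal M)=0$. Here a von Neumann algebra is diffuse if it has no minimal projection, $\|a\|_2=\tau(a^*a)^{1/2}$, and a unitary $v$ is a Haar unitary if $\tau(v^m)=0$ for all integers $m\neq0$. The upper free orbit-dimension $\mathfrak K_2$ is defined as follows. Let $\tau_k=\frac1k\mathrm{Tr}$ on $M_k(\mathbb C)$, and for $A\in M_k(\mathbb C)^n$ let $\|A\|_2^2=\sum_j\tau_k(A_j^*A_j)$.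 For $x_1,\dots,x_n\in\mathcal M$, let $\Gamma_R(x_1,\dots,x_n;m,k,\epsilon)$ be the set of all $(A_1,\dots,A_n)\in M_k(\mathbb C)^n$ with operator norms $\|A_j\|\le R$ and $$|\tau_k(A_{i_1}^{\eta_1}\cdots A_{i_q}^{\eta_q})-\tau(x_{i_1}^{\eta_1}\cdots x_{i_q}^{\eta_q})|<\epsilon$$ for all $1\le q\le m$, $1\le i_1,\dots,i_q\le n$ and $\eta_1,\dots,\eta_q\in\{1,*\}$. The $\omega$-orbit-ball around $B\in M_k(\mathbb C)^n$ is the set of all $A$ such that $\|(A_1-WB_1W^*,\dots,A_n-WB_nW^*)\|_2<\omega$ for some unitary matrix $W$. For $\Gamma\subseteq M_k(\mathbb C)^n$ let $\nu(\Gamma,\omega)$ be the minimal number of $\omega$-orbit-balls with centers in $\Gamma$ that cover $\Gamma$; so $\nu(\emptyset,\omega)=0$, and then $\log\nu(\emptyset,\omega)$ is read as $0$. Put $$\mathfrak K_2(x_1,\dots,x_n)=\sup_{0<\omega<1}\ \sup_{R>0}\ \inf_{m\in\mathbb N,\,\epsilon>0}\ \limsup_{k\to\infty}\frac{\log\nu(\Gamma_R(x_1,\dots,x_n;m,k,\epsilon),\omega)}{-k^2\log\omega}.$$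 For a finitely generated von Neumann algebra with a normal tracial state, $\mathfrak K_2$ is the supremum of $\mathfrak K_2(x_1,\dots,x_n)$ over all finite families $x_1,\dots,x_n$ that generate it as a von Neumann algebra. -/

import Mathlib

noncomputable section

namespace FreeOrbit

open Filter Topology

/-! ### Matrix tuples: norms, orbit-balls, orbit covering numbers -/

/-- The tuples in `M_k(ℂ)ⁿ`. -/
abbrev MatTuple (n k : ℕ) : Type := Fin n → Matrix (Fin k) (Fin k) ℂ

/-- The normalized trace `τ_k = (1/k) Tr` on `M_k(ℂ)`. -/
def normTrace {k : ℕ} (A : Matrix (Fin k) (Fin k) ℂ) : ℂ := A.trace / (k : ℂ)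

/-- The operator norm of a matrix acting on the Hilbert space `ℂᵏ`. -/
def opNorm {k : ℕ} (A : Matrix (Fin k) (Fin k) ℂ) : ℝ :=
  ‖Matrix.toEuclideanCLM (n := Fin k) (𝕜 := ℂ) A‖

/-- The trace norm on tuples, `‖(A₁, …, Aₙ)‖₂² = τ_k(A₁⋆ A₁) + ⋯ + τ_k(Aₙ⋆ Aₙ)`. -/
def tupleNorm2 {n k : ℕ} (A : MatTuple n k) : ℝ :=
  Real.sqrt (∑ j, (normTrace (star (A j) * A j)).re)

/-- The `ω`-orbit-ball centred at `B`: the tuples that are at `‖·‖₂`-distance less than `ω` from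
some tuple `(W B₁ W⋆, …, W Bₙ W⋆)` with `W` a unitary matrix. -/
def orbitBall {n k : ℕ} (B : MatTuple n k) (ω : ℝ) : Set (MatTuple n k) :=
  {A | ∃ W ∈ Matrix.unitaryGroup (Fin k) ℂ, tupleNorm2 (fun j => A j - W * B j * star W) < ω}

/-- The `ω`-orbit covering number of `Γ`: the minimal number of `ω`-orbit-balls with centres
in `Γ` that cover `Γ`. -/
def orbitCoveringNumber {n k : ℕ} (Γ : Set (MatTuple n k)) (ω : ℝ) : ℕ∞ :=
  ⨅ (F : Set (MatTuple n k)) (_ : F ⊆ Γ) (_ : Γ ⊆ ⋃ B ∈ F, orbitBall B ω), F.encard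

/-- `log ν` for a covering number `ν`. The empty set has `ν = 0`; its logarithm is taken to
be `0`, so that the free orbit-dimensions are nonnegative. For `ν ≥ 1` the maximum is `log ν`. -/
def logCount (ν : ℕ∞) : EReal := max 0 (ENNReal.log (ν : ENNReal))

/-! ### Microstates and the upper free orbit-dimension of a tuple -/

/-- The value at `x` of a word in the letters `x_i` (`(i, false)`) and `x_i⋆` (`(i, true)`). -/
def wordEval {A : Type*} [Monoid A] [Star A] {n : ℕ} (x : Fin n → A)
    (w : List (Fin n × Bool)) : A :=
  (w.map fun p => if p.2 then star (x p.1) else x p.1).prod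

/-- The microstate space `Γ_R(x₁, …, xₙ; m, k, ε)`: tuples of matrices of operator norm at
most `R` whose `⋆`-moments of orders `1, …, m` differ from those of `x` by less than `ε`. -/
def microstates {A : Type*} [Monoid A] [Star A] (τ : A → ℂ) {n : ℕ} (x : Fin n → A)
    (R : ℝ) (m k : ℕ) (ε : ℝ) : Set (MatTuple n k) :=
  {B | (∀ j, opNorm (B j) ≤ R) ∧
    ∀ w : List (Fin n × Bool), 1 ≤ w.length → w.length ≤ m →
      ‖normTrace (wordEval B w) - τ (wordEval x w)‖ < ε}

/-- `𝔎(x₁, …, xₙ; ω, R)`. -/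
def orbitDimAtRadius {A : Type*} [Monoid A] [Star A] (τ : A → ℂ) {n : ℕ} (x : Fin n → A)
    (ω R : ℝ) : EReal :=
  ⨅ (m : ℕ) (ε : ℝ) (_ : 0 < ε),
    limsup (fun k : ℕ => logCount (orbitCoveringNumber (microstates τ x R m k ε) ω) /
      ((-(k : ℝ) ^ 2 * Real.log ω : ℝ) : EReal)) atTop

/-- `𝔎(x₁, …, xₙ; ω)`. -/
def orbitDimAt {A : Type*} [Monoid A] [Star A] (τ : A → ℂ) {n : ℕ} (x : Fin n → A)
    (ω : ℝ) : EReal :=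
  ⨆ (R : ℝ) (_ : 0 < R), orbitDimAtRadius τ x ω R

/-- The upper free orbit-dimension `𝔎₂(x₁, …, xₙ)` of a tuple. -/
def upperOrbitDimTuple {A : Type*} [Monoid A] [Star A] (τ : A → ℂ) {n : ℕ} (x : Fin n → A) :
    EReal :=
  ⨆ (ω : ℝ) (_ : 0 < ω) (_ : ω < 1), orbitDimAt τ x ω

/-! ### Von Neumann algebras -/

variable {H : Type*} [NormedAddCommGroup H] [InnerProductSpace ℂ H] [CompleteSpace H]

/-- `S` generates `M` as a von Neumann algebra: the double commutant of `S ∪ S⋆` is `M`. -/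
def Generates (S : Set (H →L[ℂ] H)) (M : VonNeumannAlgebra H) : Prop :=
  Set.centralizer (Set.centralizer (S ∪ star S)) = (M : Set (H →L[ℂ] H))

/-- `M` is diffuse: it has no minimal projection, i.e. every nonzero projection of `M` dominates
a different nonzero projection of `M`. -/
def IsDiffuse (M : VonNeumannAlgebra H) : Prop :=
  ∀ p ∈ M, IsStarProjection p → p ≠ 0 →
    ∃ q ∈ M, IsStarProjection q ∧ p * q = q ∧ q ≠ 0 ∧ q ≠ p

open scoped ComplexOrder in
/-- `τ` is a normal tracial state on `M`. Normality (ultraweak continuity) of the positive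
functional `τ` is expressed as `τ = ∑ᵢ ⟨ξᵢ, · ξᵢ⟩` with `∑ᵢ ‖ξᵢ‖² < ∞`. -/
structure IsNormalTracialState (M : VonNeumannAlgebra H)
    (τ : M.toStarSubalgebra →ₗ[ℂ] ℂ) : Prop where
  map_one : τ 1 = 1
  nonneg : ∀ a, 0 ≤ τ (star a * a)
  tracial : ∀ a b, τ (a * b) = τ (b * a)
  normal : ∃ ξ : ℕ → H, (Summable fun i => ‖ξ i‖ ^ 2) ∧
    ∀ a : M.toStarSubalgebra, HasSum (fun i => inner ℂ (ξ i) ((a : H →L[ℂ] H) (ξ i))) (τ a)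

/-- The restriction of a linear functional on `M` to a von Neumann subalgebra `N`. -/
def restrict {N M : VonNeumannAlgebra H} (h : N ≤ M) (τ : M.toStarSubalgebra →ₗ[ℂ] ℂ) :
    N.toStarSubalgebra →ₗ[ℂ] ℂ :=
  τ ∘ₗ (StarSubalgebra.inclusion (S₁ := N.toStarSubalgebra) (S₂ := M.toStarSubalgebra)
    h).toAlgHom.toLinearMap

/-- The upper free orbit-dimension `𝔎₂(M)`: the supremum of `𝔎₂(x₁, …, xₙ)` over all finite
families that generate `M`. (If `M` is not finitely generated, the value is `⊥ = -∞`, so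
`upperOrbitDim M τ = 0` includes the assertion that `M` is finitely generated.) -/
def upperOrbitDim (M : VonNeumannAlgebra H) (τ : M.toStarSubalgebra →ₗ[ℂ] ℂ) : EReal :=
  ⨆ (n : ℕ) (x : Fin n → M.toStarSubalgebra)
    (_ : Generates (Set.range fun i => (x i : H →L[ℂ] H)) M), upperOrbitDimTuple τ x

/-- `v` is a Haar unitary: a unitary with `τ(vᵐ) = 0` for all integers `m ≠ 0`. -/
def IsHaarUnitary {M : VonNeumannAlgebra H} (τ : M.toStarSubalgebra →ₗ[ℂ] ℂ)
    (v : M.toStarSubalgebra) : Prop :=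
  v ∈ unitary M.toStarSubalgebra ∧ ∀ m : ℕ, m ≠ 0 → τ (v ^ m) = 0 ∧ τ (star v ^ m) = 0

/-- The norm `‖a‖₂ = τ(a⋆ a)^{1/2}`. -/
def norm2 {M : VonNeumannAlgebra H} (τ : M.toStarSubalgebra →ₗ[ℂ] ℂ)
    (a : M.toStarSubalgebra) : ℝ :=
  Real.sqrt (τ (star a * a)).re

end FreeOrbit

end

/-!
Let `x` generate `N`, let `y` generate `M`, and let `v`, `w` be Haar unitaries of `N` with
`v u ≈ u w`. The pair `(u, x)` generates `M`, so that `M` is finitely generated, and a microstate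
`B` of `y` is determined up to a small error by the matrices `(U, X) = Z(B)` obtained from
`⋆`-polynomials `Z` in `y` that approximate `(u, x)`. It suffices to count the pairs `(U, X)` up to
unitary conjugation.

* The tuple `X` is a microstate of `x`. Since `𝔎₂(x) = 0`, all such `X` lie in `exp(o(k²))`
  orbit-balls, of any prescribed radius.
* Once `X` is fixed up to a small error, `U` is almost fixed by the linear operator
  `T : U ↦ (1/N) ∑_{l<N} V_l(X) U W_l(X)⋆`, where `V_l` and `W_l` approximate `v^l` and `w^l`,
  because `v^l u (w^l)⋆ ≈ u`. The relations `τ((v^l)⋆ v^{l'}) = δ_{l l'}` for Haar unitaries imply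
  that the squared Hilbert–Schmidt norm of `T` on the `k²`-dimensional space `M_k(ℂ)` is at most
  `2 k² / N` (`sum_norm_averaging_sq_le`). An operator with this property is small outside a subspace
  of dimension `O(k² / N)`, so its approximate fixed points of bounded norm are covered by
  `exp(O(k² / N))` balls of a fixed radius (`exists_net_averaging`). Here `N` is arbitrarily large.

The two counts are combined in `exists_orbitCoveringNumber_le`, and the parameters are chosen in
`upperOrbitDimTuple_le_zero_of_averaging`.

The `⋆`-polynomials `Z` exist by two density results. A form of the double commutant theorem on
`ℓ²(ℕ, H)` (`exists_norm_amplify_sub_lt`) and the normality of `τ` show that the `⋆`-polynomials in a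
generating tuple are dense for the 2-norm. The operator norms of `Z(B)` have to stay bounded,
independently of the accuracy of the approximation, because the radius of the microstates of `x` is
fixed before the accuracy. A Kaplansky-type argument with the function `t ↦ t / (1 + t²)`, which is
Lipschitz for the 2-norm and can be replaced by a real polynomial on bounded sets, provides this
bound at all matrix tuples simultaneously (`exists_bounded_poly`).
-/

noncomputable section

namespace FreeOrbit

open Filter Topology
open scoped ComplexOrder Matrix.Norms.L2Operator ENNReal

/-! ### Tracial states and their 2-norms -/

/-- A tracial state on a complex `⋆`-algebra: a unital linear functional that is positive and a
trace. Both `M` and the matrix algebras `M_k(ℂ)` with `k > 0` carry one. -/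
structure IsTracialState {A : Type*} [Ring A] [StarRing A] [Algebra ℂ A] (τ : A →ₗ[ℂ] ℂ) :
    Prop where
  map_one : τ 1 = 1
  nonneg : ∀ a, 0 ≤ τ (star a * a)
  tracial : ∀ a b, τ (a * b) = τ (b * a)

/-- The seminorm `‖a‖₂ = τ(a⋆ a)^{1/2}` of a functional on a `⋆`-algebra. -/
def traceNorm {A : Type*} [Ring A] [StarRing A] [Algebra ℂ A] (τ : A →ₗ[ℂ] ℂ) (a : A) : ℝ :=
  Real.sqrt (τ (star a * a)).re

section TraceNorm

variable {A : Type*} [Ring A] [StarRing A] [Algebra ℂ A]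

lemma traceNorm_nonneg (τ : A →ₗ[ℂ] ℂ) (a : A) : 0 ≤ traceNorm τ a :=
  Real.sqrt_nonneg _

lemma traceNorm_zero (τ : A →ₗ[ℂ] ℂ) : traceNorm τ 0 = 0 := by simp [traceNorm]

lemma traceNorm_neg (τ : A →ₗ[ℂ] ℂ) (a : A) :
    traceNorm τ (-a) = traceNorm τ a := by simp [traceNorm]

lemma traceNorm_sub_comm (τ : A →ₗ[ℂ] ℂ) (a b : A) :
    traceNorm τ (a - b) = traceNorm τ (b - a) := by rw [← traceNorm_neg, neg_sub]

lemma traceNorm_smul [StarModule ℂ A] (τ : A →ₗ[ℂ] ℂ) (c : ℂ) (a : A) :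
    traceNorm τ (c • a) = ‖c‖ * traceNorm τ a := by
  rw [traceNorm, traceNorm, star_smul, smul_mul_smul_comm, map_smul, smul_eq_mul,
    show star c * c = ((‖c‖ ^ 2 : ℝ) : ℂ) by
      rw [Complex.star_def, ← Complex.normSq_eq_conj_mul_self, Complex.normSq_eq_norm_sq],
    Complex.re_ofReal_mul, Real.sqrt_mul (by positivity), Real.sqrt_sq (norm_nonneg _)]

lemma traceNorm_unitary_mul (τ : A →ₗ[ℂ] ℂ) {w : A} (hw : w ∈ unitary A) (a : A) :
    traceNorm τ (w * a) = traceNorm τ a := by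
  rw [traceNorm, traceNorm, star_mul, mul_assoc, ← mul_assoc (star w),
    Unitary.star_mul_self_of_mem hw, one_mul]

end TraceNorm

namespace IsTracialState

section Algebraic

variable {A : Type*} [Ring A] [StarRing A] [Algebra ℂ A] {τ : A →ₗ[ℂ] ℂ}

lemma re_nonneg (hτ : IsTracialState τ) (a : A) : 0 ≤ (τ (star a * a)).re :=
  (Complex.le_def.1 (hτ.nonneg a)).1

lemma sq_traceNorm (hτ : IsTracialState τ) (a : A) : traceNorm τ a ^ 2 = (τ (star a * a)).re :=
  Real.sq_sqrt (hτ.re_nonneg a)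

lemma traceNorm_star (hτ : IsTracialState τ) (a : A) :
    traceNorm τ (star a) = traceNorm τ a := by
  rw [traceNorm, traceNorm, star_star, hτ.tracial]

lemma traceNorm_one (hτ : IsTracialState τ) : traceNorm τ 1 = 1 := by
  simp [traceNorm, hτ.map_one]

lemma traceNorm_mul_unitary (hτ : IsTracialState τ) {w : A} (hw : w ∈ unitary A) (a : A) :
    traceNorm τ (a * w) = traceNorm τ a := by
  rw [← hτ.traceNorm_star, star_mul, traceNorm_unitary_mul τ (Unitary.star_mem hw),
    hτ.traceNorm_star]

variable [StarModule ℂ A]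

lemma map_star (hτ : IsTracialState τ) (a : A) : τ (star a) = star (τ a) := by
  -- Polarization: `τ(b⋆ b)` is real for `b = a + 1` and for `b = a + i`.
  have key : ∀ c : ℂ, (τ (star (a + c • (1 : A)) * (a + c • (1 : A)))).im = 0 := fun c =>
    (Complex.le_def.1 (hτ.nonneg _)).2.symm
  have e0 : (τ (star a * a)).im = 0 := (Complex.le_def.1 (hτ.nonneg _)).2.symm
  have h1 := key 1
  have h2 := key Complex.I
  simp only [star_add, star_smul, star_one, add_mul, mul_add, mul_one, one_mul, smul_mul_assoc,
    mul_smul_comm, map_add, map_smul, hτ.map_one, smul_eq_mul, Complex.add_im, e0] at h1 h2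
  apply Complex.ext
  · simp [Complex.mul_im] at h2 ⊢
    linarith
  · simp at h1 ⊢
    linarith

/-- The semi-inner product `⟨a, b⟩ = τ(a⋆ b)` of a tracial state. -/
@[reducible] def innerCore (hτ : IsTracialState τ) : PreInnerProductSpace.Core ℂ A where
  inner a b := τ (star a * b)
  conj_inner_symm a b := by
    have := hτ.map_star (star b * a)
    simp only [star_mul, star_star] at this
    rw [this, starRingEnd_apply]
  re_inner_nonneg a := hτ.re_nonneg a
  add_left a b c := by simp [add_mul]
  smul_left a b r := by simp

lemma norm_map_star_mul_le (hτ : IsTracialState τ) (a b : A) :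
    ‖τ (star a * b)‖ ≤ traceNorm τ a * traceNorm τ b := by
  let _ := hτ.innerCore
  exact InnerProductSpace.Core.norm_inner_le_norm (𝕜 := ℂ) a b

lemma traceNorm_add_le (hτ : IsTracialState τ) (a b : A) :
    traceNorm τ (a + b) ≤ traceNorm τ a + traceNorm τ b := by
  let _ := hτ.innerCore
  let _ : SeminormedAddCommGroup A := InnerProductSpace.Core.toSeminormedAddCommGroup (𝕜 := ℂ)
  exact norm_add_le a b

lemma norm_map_le (hτ : IsTracialState τ) (a : A) : ‖τ a‖ ≤ traceNorm τ a := by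
  simpa [hτ.traceNorm_one] using hτ.norm_map_star_mul_le 1 a

lemma traceNorm_sub_le (hτ : IsTracialState τ) (a b c : A) :
    traceNorm τ (a - c) ≤ traceNorm τ (a - b) + traceNorm τ (b - c) := by
  simpa using hτ.traceNorm_add_le (a - b) (b - c)

lemma traceNorm_le_add (hτ : IsTracialState τ) (a b : A) :
    traceNorm τ a ≤ traceNorm τ b + traceNorm τ (a - b) := by
  simpa using hτ.traceNorm_add_le b (a - b)

lemma traceNorm_sum_le (hτ : IsTracialState τ) {ι : Type*} (s : Finset ι) (f : ι → A) :
    traceNorm τ (∑ i ∈ s, f i) ≤ ∑ i ∈ s, traceNorm τ (f i) :=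
  Finset.le_sum_of_subadditive _ (traceNorm_zero τ).le hτ.traceNorm_add_le s f

end Algebraic

section CStar

variable {A : Type*} [CStarAlgebra A] {τ : A →ₗ[ℂ] ℂ}

/-- Left multiplication by `a` has norm at most `‖a‖` for the 2-norm, because `‖a‖² - a⋆ a` is of the
form `c⋆ c`. -/
lemma traceNorm_mul_le (hτ : IsTracialState τ) (a b : A) :
    traceNorm τ (a * b) ≤ ‖a‖ * traceNorm τ b := by
  let _ := CStarAlgebra.spectralOrder A
  have := CStarAlgebra.spectralOrderedRing A
  obtain ⟨c, hc⟩ := CStarAlgebra.nonneg_iff_eq_star_mul_self.1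
    (sub_nonneg.2 (CStarAlgebra.star_mul_le_algebraMap_norm_sq (a := a)))
  have h : star (a * b) * (a * b) + star (c * b) * (c * b) = ((‖a‖ ^ 2 : ℝ) : ℂ) • (star b * b) := by
    have : star c * c = ((‖a‖ ^ 2 : ℝ) : ℂ) • (1 : A) - star a * a := by
      rw [← hc, Algebra.algebraMap_eq_smul_one, Complex.coe_smul]
    simp only [star_mul, mul_assoc]
    rw [← mul_assoc (star c), this, ← mul_assoc (star a)]
    simp [sub_mul, mul_sub]
  have h2 := congrArg (fun z => (τ z).re) h
  simp only [map_add, Complex.add_re, map_smul, smul_eq_mul, Complex.re_ofReal_mul] at h2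
  have h3 := hτ.re_nonneg (c * b)
  rw [traceNorm, traceNorm, ← Real.sqrt_sq (norm_nonneg a), ← Real.sqrt_mul (by positivity)]
  apply Real.sqrt_le_sqrt
  linarith

lemma traceNorm_mul_le' (hτ : IsTracialState τ) (a b : A) :
    traceNorm τ (a * b) ≤ traceNorm τ a * ‖b‖ := by
  rw [← hτ.traceNorm_star, star_mul, mul_comm]
  simpa [hτ.traceNorm_star] using hτ.traceNorm_mul_le (star b) (star a)

lemma traceNorm_le_norm (hτ : IsTracialState τ) (a : A) : traceNorm τ a ≤ ‖a‖ := by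
  simpa [hτ.traceNorm_one] using hτ.traceNorm_mul_le a 1

end CStar

end IsTracialState

/-- The normalized trace as a linear functional. -/
def normTraceLinear (k : ℕ) : Matrix (Fin k) (Fin k) ℂ →ₗ[ℂ] ℂ :=
  (k : ℂ)⁻¹ • Matrix.traceLinearMap (Fin k) ℂ ℂ

lemma normTraceLinear_apply {k : ℕ} (A : Matrix (Fin k) (Fin k) ℂ) :
    normTraceLinear k A = normTrace A := by
  simp [normTraceLinear, normTrace, div_eq_inv_mul]

lemma isTracialState_normTraceLinear {k : ℕ} (hk : 0 < k) :
    IsTracialState (normTraceLinear k) where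
  map_one := by
    have : (k : ℂ) ≠ 0 := by exact_mod_cast hk.ne'
    simp [normTraceLinear, this]
  nonneg a := by
    simp only [normTraceLinear, LinearMap.smul_apply, Matrix.traceLinearMap_apply, smul_eq_mul]
    have h : (0 : ℂ) ≤ (star a * a).trace := by
      rw [Matrix.star_eq_conjTranspose]
      exact (Matrix.posSemidef_conjTranspose_mul_self a).trace_nonneg
    exact mul_nonneg (by simp) h
  tracial a b := by
    simp [normTraceLinear, Matrix.trace_mul_comm a b]

lemma tupleNorm2_eq {n k : ℕ} (A : MatTuple n k) :
    tupleNorm2 A = Real.sqrt (∑ j, (normTraceLinear k (star (A j) * A j)).re) := by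
  simp only [tupleNorm2, normTraceLinear_apply]

lemma tupleNorm2_le_sum {n k : ℕ} (hk : 0 < k) (A : MatTuple n k) :
    tupleNorm2 A ≤ ∑ j, traceNorm (normTraceLinear k) (A j) := by
  rw [tupleNorm2_eq]
  refine Real.sqrt_le_iff.2 ⟨Finset.sum_nonneg fun _ _ => traceNorm_nonneg _ _, ?_⟩
  simp only [← (isTracialState_normTraceLinear hk).sq_traceNorm]
  exact Finset.sum_sq_le_sq_sum_of_nonneg fun _ _ => traceNorm_nonneg _ _

lemma traceNorm_le_tupleNorm2 {n k : ℕ} (hk : 0 < k) (A : MatTuple n k) (j : Fin n) :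
    traceNorm (normTraceLinear k) (A j) ≤ tupleNorm2 A := by
  rw [tupleNorm2_eq, traceNorm]
  apply Real.sqrt_le_sqrt
  exact Finset.single_le_sum
    (f := fun j => (normTraceLinear k (star (A j) * A j)).re)
    (fun i _ => (isTracialState_normTraceLinear hk).re_nonneg _) (Finset.mem_univ j)

/-! ### Noncommutative `⋆`-polynomials -/

/-- Formal noncommutative `⋆`-polynomials in `n` variables. They are syntactic expressions: two
expressions that agree in every `⋆`-algebra are not identified, so that bounds and Lipschitz
constants can be defined by recursion. -/
inductive NCPoly (n : ℕ) : Type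
  | const (c : ℂ) : NCPoly n
  | var (i : Fin n) : NCPoly n
  | add (P Q : NCPoly n) : NCPoly n
  | mul (P Q : NCPoly n) : NCPoly n
  | adj (P : NCPoly n) : NCPoly n

namespace NCPoly

variable {n : ℕ}

/-- The value of a `⋆`-polynomial at a tuple of elements of a `⋆`-algebra. -/
def eval {A : Type*} [Ring A] [StarRing A] [Algebra ℂ A] (x : Fin n → A) : NCPoly n → A
  | const c => algebraMap ℂ A c
  | var i => x i
  | add P Q => P.eval x + Q.eval x
  | mul P Q => P.eval x * Q.eval x
  | adj P => star (P.eval x)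

/-- A bound for the norm of the values of a `⋆`-polynomial at tuples of norm at most `R`. The
absolute value `|R|` makes it nonnegative for every `R`. -/
def bound (R : ℝ) : NCPoly n → ℝ
  | const c => ‖c‖
  | var _ => |R|
  | add P Q => P.bound R + Q.bound R
  | mul P Q => P.bound R * Q.bound R
  | adj P => P.bound R

/-- A Lipschitz constant, for the 2-norm, of a `⋆`-polynomial on the tuples of operator norm at
most `R`. -/
def lip (R : ℝ) : NCPoly n → ℝ
  | const _ => 0
  | var _ => 1
  | add P Q => P.lip R + Q.lip R
  | mul P Q => P.lip R * Q.bound R + P.bound R * Q.lip R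
  | adj P => P.lip R

/-- Substitution of `⋆`-polynomials for the variables. -/
def subst {m : ℕ} (f : Fin n → NCPoly m) : NCPoly n → NCPoly m
  | const c => const c
  | var i => f i
  | add P Q => add (P.subst f) (Q.subst f)
  | mul P Q => mul (P.subst f) (Q.subst f)
  | adj P => adj (P.subst f)

/-- The sum of a list of `⋆`-polynomials. -/
def sum (l : List (NCPoly n)) : NCPoly n := l.foldr add (const 0)

/-- Powers of a `⋆`-polynomial. -/
def pow (P : NCPoly n) : ℕ → NCPoly n
  | 0 => const 1
  | k + 1 => mul (P.pow k) P

/-- The difference of two `⋆`-polynomials. -/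
def sub (P Q : NCPoly n) : NCPoly n := add P (mul (const (-1)) Q)

/-- A real polynomial in one variable, applied to a `⋆`-polynomial. -/
def applyPolynomial (g : Polynomial ℝ) (P : NCPoly n) : NCPoly n :=
  sum ((List.range (g.natDegree + 1)).map fun i => mul (const (g.coeff i : ℂ)) (P.pow i))

/-- A word in the letters `x_i` and `x_i⋆`, as a `⋆`-polynomial. -/
def ofWord (w : List (Fin n × Bool)) : NCPoly n :=
  (w.map fun p => if p.2 then adj (var p.1) else var p.1).foldr mul (const 1)

/-- The expansion of a `⋆`-polynomial as a linear combination of words. -/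
def terms : NCPoly n → List (ℂ × List (Fin n × Bool))
  | const c => [(c, [])]
  | var i => [(1, [(i, false)])]
  | add P Q => P.terms ++ Q.terms
  | mul P Q => P.terms.flatMap fun t => Q.terms.map fun s => (t.1 * s.1, t.2 ++ s.2)
  | adj P => P.terms.map fun t => (star t.1, (t.2.map fun p => (p.1, !p.2)).reverse)

section Words

variable {A : Type*} [Monoid A] [StarMul A]

lemma wordEval_append (x : Fin n → A) (v w : List (Fin n × Bool)) :
    wordEval x (v ++ w) = wordEval x v * wordEval x w := by
  simp [wordEval]

lemma star_wordEval (x : Fin n → A) (w : List (Fin n × Bool)) :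
    star (wordEval x w) = wordEval x (w.map fun p => (p.1, !p.2)).reverse := by
  induction w with
  | nil => simp [wordEval]
  | cons p w ih =>
    rw [List.map_cons, List.reverse_cons, wordEval_append, ← ih]
    rcases p with ⟨i, b⟩
    cases b <;> simp [wordEval]

end Words

section Algebraic

variable {A : Type*} [Ring A] [StarRing A] [Algebra ℂ A]

@[simp] lemma eval_const (x : Fin n → A) (c : ℂ) : (const c).eval x = algebraMap ℂ A c := rfl
@[simp] lemma eval_var (x : Fin n → A) (i : Fin n) : (var i).eval x = x i := rfl
@[simp] lemma eval_add (x : Fin n → A) (P Q : NCPoly n) :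
    (add P Q).eval x = P.eval x + Q.eval x := rfl
@[simp] lemma eval_mul (x : Fin n → A) (P Q : NCPoly n) :
    (mul P Q).eval x = P.eval x * Q.eval x := rfl
@[simp] lemma eval_adj (x : Fin n → A) (P : NCPoly n) : (adj P).eval x = star (P.eval x) := rfl

@[simp] lemma eval_sub (x : Fin n → A) (P Q : NCPoly n) :
    (sub P Q).eval x = P.eval x - Q.eval x := by
  simp [sub, sub_eq_add_neg]

@[simp] lemma eval_sum (x : Fin n → A) (l : List (NCPoly n)) :
    (sum l).eval x = (l.map fun P => P.eval x).sum := by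
  induction l with
  | nil => simp [sum]
  | cons P l ih => rw [List.map_cons, List.sum_cons, ← ih]; rfl

@[simp] lemma eval_pow (x : Fin n → A) (P : NCPoly n) (k : ℕ) :
    (P.pow k).eval x = P.eval x ^ k := by
  induction k with
  | zero => simp [pow]
  | succ k ih => simp [pow, ih, pow_succ]

@[simp] lemma eval_subst {m : ℕ} (f : Fin n → NCPoly m) (x : Fin m → A) (P : NCPoly n) :
    (P.subst f).eval x = P.eval fun i => (f i).eval x := by
  induction P with
  | const c => rfl
  | var i => rfl
  | add P Q hP hQ => simp [subst, hP, hQ]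
  | mul P Q hP hQ => simp [subst, hP, hQ]
  | adj P hP => simp [subst, hP]

lemma eval_ofWord (x : Fin n → A) (w : List (Fin n × Bool)) :
    (ofWord w).eval x = wordEval x w := by
  induction w with
  | nil => simp [ofWord, wordEval]
  | cons p w ih =>
    simp only [ofWord, wordEval, List.map_cons, List.foldr_cons, List.prod_cons, eval_mul] at ih ⊢
    rw [ih]
    cases p.2 <;> simp

lemma map_eval {B : Type*} [Ring B] [StarRing B] [Algebra ℂ B] (φ : A →⋆ₐ[ℂ] B) (x : Fin n → A)
    (P : NCPoly n) : φ (P.eval x) = P.eval fun i => φ (x i) := by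
  induction P with
  | const c => simp [AlgHomClass.commutes φ c]
  | var i => rfl
  | add P Q hP hQ => simp [hP, hQ]
  | mul P Q hP hQ => simp [hP, hQ]
  | adj P hP => simp [map_star, hP]

lemma eval_unitary_conj {w : A} (hw : w ∈ unitary A) (x : Fin n → A) (P : NCPoly n) :
    (P.eval fun i => star w * x i * w) = star w * P.eval x * w := by
  have h1 : star w * w = 1 := Unitary.star_mul_self_of_mem hw
  have h2 : ∀ a, w * (star w * a) = a := fun a => by
    rw [← mul_assoc, Unitary.mul_star_self_of_mem hw, one_mul]
  induction P with
  | const c => simp [mul_assoc, Algebra.commutes c w]; rw [← mul_assoc, h1, one_mul]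
  | var i => rfl
  | add P Q hP hQ => simp [hP, hQ, mul_add, add_mul]
  | mul P Q hP hQ => rw [eval_mul, eval_mul, hP, hQ]; simp [mul_assoc, h2]
  | adj P hP => rw [eval_adj, eval_adj, hP]; simp [mul_assoc]

lemma eval_applyPolynomial (g : Polynomial ℝ) (P : NCPoly n)
    (x : Fin n → A) : (P.applyPolynomial g).eval x = Polynomial.aeval (P.eval x) g := by
  rw [Polynomial.aeval_eq_sum_range, applyPolynomial, eval_sum, List.map_map]
  generalize g.natDegree + 1 = d
  induction d with
  | zero => simp
  | succ d ih =>
    rw [Finset.sum_range_succ, ← ih, List.range_succ]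
    simp [← Algebra.smul_def]

lemma eval_eq_sum_terms [StarModule ℂ A] (x : Fin n → A) (P : NCPoly n) :
    P.eval x = (P.terms.map fun t => t.1 • wordEval x t.2).sum := by
  induction P with
  | const c => simp [terms, wordEval, Algebra.algebraMap_eq_smul_one]
  | var i => simp [terms, wordEval]
  | add P Q hP hQ => simp [terms, hP, hQ]
  | mul P Q hP hQ =>
    rw [eval_mul, hP, hQ, terms, List.map_flatMap]
    generalize P.terms = l
    induction l with
    | nil => simp
    | cons t l ih =>
      simp only [List.map_cons, List.sum_cons, add_mul, ih, List.flatMap_cons, List.sum_append,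
        List.map_map]
      congr 1
      rw [← List.sum_map_mul_left]
      simp [Function.comp_def, wordEval_append, smul_smul, mul_comm t.1]
  | adj P hP =>
    rw [eval_adj, hP, terms]
    generalize P.terms = l
    induction l with
    | nil => simp
    | cons t l ih => simp [ih, star_wordEval]

end Algebraic

section Bounds

lemma bound_nonneg (R : ℝ) (P : NCPoly n) : 0 ≤ P.bound R := by
  induction P with
  | const c => exact norm_nonneg c
  | var i => exact abs_nonneg R
  | add P Q hP hQ => exact add_nonneg hP hQ
  | mul P Q hP hQ => exact mul_nonneg hP hQ
  | adj P hP => exact hP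

lemma lip_nonneg (R : ℝ) (P : NCPoly n) : 0 ≤ P.lip R := by
  induction P with
  | const c => exact le_rfl
  | var i => exact zero_le_one
  | add P Q hP hQ => exact add_nonneg hP hQ
  | mul P Q hP hQ =>
    exact add_nonneg (mul_nonneg hP (Q.bound_nonneg R)) (mul_nonneg (P.bound_nonneg R) hQ)
  | adj P hP => exact hP

variable {A : Type*} [CStarAlgebra A]

lemma norm_eval_le {R : ℝ} {x : Fin n → A} (hx : ∀ i, ‖x i‖ ≤ R) (P : NCPoly n) :
    ‖P.eval x‖ ≤ P.bound R := by
  induction P with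
  | const c =>
    rcases subsingleton_or_nontrivial A with h | h
    · simp [Subsingleton.elim (algebraMap ℂ A c) 0, bound]
    · simp [bound]
  | var i => exact (hx i).trans (le_abs_self R)
  | add P Q hP hQ => exact (norm_add_le _ _).trans (add_le_add hP hQ)
  | mul P Q hP hQ =>
    exact (norm_mul_le _ _).trans (mul_le_mul hP hQ (norm_nonneg _) (P.bound_nonneg R))
  | adj P hP => rwa [eval_adj, norm_star]

lemma traceNorm_eval_sub_le {τ : A →ₗ[ℂ] ℂ} (hτ : IsTracialState τ) {R d : ℝ} {x y : Fin n → A}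
    (hx : ∀ i, ‖x i‖ ≤ R) (hy : ∀ i, ‖y i‖ ≤ R) (hd : 0 ≤ d)
    (hxy : ∀ i, traceNorm τ (x i - y i) ≤ d) (P : NCPoly n) :
    traceNorm τ (P.eval x - P.eval y) ≤ P.lip R * d := by
  induction P with
  | const c => simp [lip, traceNorm_zero]
  | var i => simpa [lip] using hxy i
  | add P Q hP hQ =>
    rw [eval_add, eval_add, add_sub_add_comm, lip, add_mul]
    exact (hτ.traceNorm_add_le _ _).trans (add_le_add hP hQ)
  | mul P Q hP hQ =>
    have e : (mul P Q).eval x - (mul P Q).eval y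
        = (P.eval x - P.eval y) * Q.eval x + P.eval y * (Q.eval x - Q.eval y) := by
      simp [sub_mul, mul_sub]
    rw [e]
    refine (hτ.traceNorm_add_le _ _).trans ?_
    have h1 : traceNorm τ ((P.eval x - P.eval y) * Q.eval x) ≤ P.lip R * d * Q.bound R :=
      (hτ.traceNorm_mul_le' _ _).trans
        (mul_le_mul hP (Q.norm_eval_le hx) (norm_nonneg _) (mul_nonneg (P.lip_nonneg R) hd))
    have h2 : traceNorm τ (P.eval y * (Q.eval x - Q.eval y)) ≤ P.bound R * (Q.lip R * d) :=
      (hτ.traceNorm_mul_le _ _).trans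
        (mul_le_mul (P.norm_eval_le hy) hQ (traceNorm_nonneg _ _) (P.bound_nonneg R))
    calc _ ≤ P.lip R * d * Q.bound R + P.bound R * (Q.lip R * d) := add_le_add h1 h2
      _ = _ := by rw [lip]; ring
  | adj P hP => rwa [eval_adj, eval_adj, ← star_sub, hτ.traceNorm_star]

end Bounds

end NCPoly

/-! ### The filter of microstates -/

/-- The filter on matrix tuples of all sizes whose members contain all microstates of `x` of some
order `m` and precision `ε`. The size `k = 0` is left out because the normalized trace on
`M_0(ℂ)` is not unital. -/
def microFilter {A : Type*} [Monoid A] [Star A] (τ : A → ℂ) {n : ℕ} (x : Fin n → A) (R : ℝ) :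
    Filter (Σ k, MatTuple n k) :=
  ⨅ q : ℕ × {ε : ℝ // 0 < ε}, 𝓟 {b | 0 < b.1 ∧ b.2 ∈ microstates τ x R q.1 b.1 q.2}

section MicroFilter

variable {A : Type*} [Monoid A] [Star A] {τ : A → ℂ} {n : ℕ} {x : Fin n → A} {R : ℝ}

lemma microstates_subset {m m' k : ℕ} {ε ε' : ℝ} (hm : m ≤ m') (hε : ε' ≤ ε) :
    microstates τ x R m' k ε' ⊆ microstates τ x R m k ε :=
  fun _ hB => ⟨hB.1, fun w h1 h2 => (hB.2 w h1 (h2.trans hm)).trans_le hε⟩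

lemma eventually_microFilter {p : (Σ k, MatTuple n k) → Prop} :
    (∀ᶠ b in microFilter τ x R, p b) ↔
      ∃ m : ℕ, ∃ ε : ℝ, 0 < ε ∧ ∀ k, 0 < k → ∀ B ∈ microstates τ x R m k ε, p ⟨k, B⟩ := by
  have hd : Directed (· ≥ ·) fun q : ℕ × {ε : ℝ // 0 < ε} =>
      {b : Σ k, MatTuple n k | 0 < b.1 ∧ b.2 ∈ microstates τ x R q.1 b.1 q.2} := by
    rintro ⟨m, ε, hε⟩ ⟨m', ε', hε'⟩
    refine ⟨⟨max m m', min ε ε', lt_min hε hε'⟩, ?_, ?_⟩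
    · exact fun b hb => ⟨hb.1, microstates_subset (le_max_left _ _) (min_le_left _ _) hb.2⟩
    · exact fun b hb => ⟨hb.1, microstates_subset (le_max_right _ _) (min_le_right _ _) hb.2⟩
  have : Nonempty (ℕ × {ε : ℝ // 0 < ε}) := ⟨⟨0, 1, one_pos⟩⟩
  rw [Filter.Eventually, microFilter, (hasBasis_iInf_principal hd).mem_iff]
  constructor
  · rintro ⟨⟨m, ε, hε⟩, -, h⟩
    exact ⟨m, ε, hε, fun k hk B hB => h ⟨hk, hB⟩⟩
  · rintro ⟨m, ε, hε, h⟩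
    exact ⟨⟨m, ε, hε⟩, trivial, fun b hb => h b.1 hb.1 b.2 hb.2⟩

lemma eventually_microFilter_pos : ∀ᶠ b in microFilter τ x R, 0 < b.1 :=
  eventually_microFilter.2 ⟨0, 1, one_pos, fun _ hk _ _ => hk⟩

lemma eventually_microFilter_opNorm_le : ∀ᶠ b in microFilter τ x R, ∀ j, ‖b.2 j‖ ≤ R :=
  eventually_microFilter.2 ⟨0, 1, one_pos, fun _ _ _ hB => hB.1⟩

end MicroFilter

section MicroTrace

variable {A : Type*} [Ring A] [StarRing A] [Algebra ℂ A] [StarModule ℂ A] {τ : A →ₗ[ℂ] ℂ} {n : ℕ}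
  {x : Fin n → A} {R : ℝ}

/-- Along microstates of `x`, the normalized trace of a `⋆`-polynomial tends to its trace at `x`. -/
lemma tendsto_normTrace_eval (h1 : τ 1 = 1) (P : NCPoly n) :
    Tendsto (fun b : Σ k, MatTuple n k => normTraceLinear b.1 (P.eval b.2)) (microFilter τ x R)
      (𝓝 (τ (P.eval x))) := by
  have hw : ∀ w : List (Fin n × Bool),
      Tendsto (fun b : Σ k, MatTuple n k => normTraceLinear b.1 (wordEval b.2 w))
        (microFilter τ x R) (𝓝 (τ (wordEval x w))) := by
    intro w
    rcases Nat.eq_zero_or_pos w.length with h | h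
    · rw [List.length_eq_zero_iff] at h
      subst h
      refine tendsto_nhds_of_eventually_eq ?_
      filter_upwards [eventually_microFilter_pos] with b hb
      simp [wordEval, h1, (isTracialState_normTraceLinear hb).map_one]
    · refine Metric.tendsto_nhds.2 fun ε hε => eventually_microFilter.2
        ⟨w.length, ε, hε, fun k _ B hB => ?_⟩
      rw [dist_eq_norm, normTraceLinear_apply]
      exact hB.2 w h le_rfl
  simp only [P.eval_eq_sum_terms]
  generalize P.terms = l
  induction l with
  | nil => simpa using tendsto_const_nhds
  | cons t l ih =>
    simp only [List.map_cons, List.sum_cons, map_add, map_smul]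
    exact ((hw t.2).const_smul t.1).add ih

lemma tendsto_traceNorm_eval (h1 : τ 1 = 1) (P : NCPoly n) :
    Tendsto (fun b : Σ k, MatTuple n k => traceNorm (normTraceLinear b.1) (P.eval b.2))
      (microFilter τ x R) (𝓝 (traceNorm τ (P.eval x))) :=
  (Real.continuous_sqrt.tendsto _).comp ((Complex.continuous_re.tendsto _).comp
    (tendsto_normTrace_eval (τ := τ) (x := x) (R := R) h1 (.mul (.adj P) P)))

end MicroTrace

/-! ### Approximation in 2-norm with uniformly bounded `⋆`-polynomials -/

/-- The `⋆`-polynomials in `y` are dense in `A` for the 2-norm of `τ`. -/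
def IsTraceDense {A : Type*} [Ring A] [StarRing A] [Algebra ℂ A] (τ : A →ₗ[ℂ] ℂ) {n : ℕ}
    (y : Fin n → A) : Prop :=
  ∀ a : A, ∀ δ : ℝ, 0 < δ → ∃ P : NCPoly n, traceNorm τ (P.eval y - a) < δ

namespace NCPoly

variable {n : ℕ}

/-- The self-adjoint part `(P + P⋆) / 2` of a `⋆`-polynomial. -/
def realPart (P : NCPoly n) : NCPoly n := mul (const (1 / 2)) (add P (adj P))

lemma isSelfAdjoint_eval_realPart {A : Type*} [Ring A] [StarRing A] [Algebra ℂ A] [StarModule ℂ A]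
    (x : Fin n → A) (P : NCPoly n) : IsSelfAdjoint (P.realPart.eval x) := by
  rw [isSelfAdjoint_iff]
  simp [realPart, ← Algebra.smul_def, add_comm]

/-- A real polynomial bounded by `c` on the spectrum of all values of the self-adjoint
`⋆`-polynomial `P.realPart` yields a `⋆`-polynomial bounded by `c`. -/
lemma norm_eval_applyPolynomial_le {A : Type*} [CStarAlgebra A] {R c : ℝ} {x : Fin n → A}
    (hx : ∀ i, ‖x i‖ ≤ R) (P : NCPoly n) (g : Polynomial ℝ) (hc : 0 ≤ c)
    (hg : ∀ t, |t| ≤ P.realPart.bound R → |g.eval t| ≤ c) :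
    ‖(P.realPart.applyPolynomial g).eval x‖ ≤ c := by
  have hsa := P.isSelfAdjoint_eval_realPart x
  rw [eval_applyPolynomial, ← cfc_polynomial g _ hsa]
  refine norm_cfc_le hc fun t ht => hg t ?_
  rcases subsingleton_or_nontrivial A with h | h
  · simp [spectrum.of_subsingleton] at ht
  · exact (spectrum.norm_le_norm_of_mem ht).trans (P.realPart.norm_eval_le hx)

end NCPoly

section CStar

variable {A : Type*} [CStarAlgebra A]

/-- The resolvent `(1 + b²)⁻¹` of a self-adjoint element, with its norm bounds. -/
lemma exists_resolvent {b : A} (hb : IsSelfAdjoint b) :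
    ∃ r : A, r * (1 + b * b) = 1 ∧ (1 + b * b) * r = 1 ∧ r * b = b * r ∧
      cfc (fun t : ℝ => t / (1 + t ^ 2)) b = r * b ∧ ‖r‖ ≤ 1 ∧ ‖r * b‖ ≤ 1 := by
  have hpos : ∀ t : ℝ, 0 < 1 + t ^ 2 := fun t => by positivity
  have hc1 : Continuous fun t : ℝ => (1 + t ^ 2)⁻¹ :=
    Continuous.inv₀ (by fun_prop) fun t => (hpos t).ne'
  have e : cfc (fun t : ℝ => 1 + t ^ 2) b = 1 + b * b := by
    rw [cfc_const_add (R := ℝ) 1 (fun t => t ^ 2) b, cfc_pow_id b 2, map_one, sq]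
  have em : cfc (fun t : ℝ => t / (1 + t ^ 2)) b = cfc (fun t : ℝ => (1 + t ^ 2)⁻¹) b * b := by
    have h := cfc_mul (fun t : ℝ => (1 + t ^ 2)⁻¹) id b hc1.continuousOn continuousOn_id
    rw [cfc_id ℝ b] at h
    rw [← h]
    congr 1
    ext t
    simp [div_eq_inv_mul]
  have em' : cfc (fun t : ℝ => t / (1 + t ^ 2)) b = b * cfc (fun t : ℝ => (1 + t ^ 2)⁻¹) b := by
    have h := cfc_mul id (fun t : ℝ => (1 + t ^ 2)⁻¹) b continuousOn_id hc1.continuousOn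
    rw [cfc_id ℝ b] at h
    rw [← h]
    congr 1
  refine ⟨cfc (fun t : ℝ => (1 + t ^ 2)⁻¹) b, ?_, ?_, em.symm.trans em', em, ?_, ?_⟩
  · rw [← e, ← cfc_mul _ _ b hc1.continuousOn (by fun_prop), ← cfc_const_one ℝ b]
    congr 1
    ext t
    exact inv_mul_cancel₀ (hpos t).ne'
  · rw [← e, ← cfc_mul _ _ b (by fun_prop) hc1.continuousOn, ← cfc_const_one ℝ b]
    congr 1
    ext t
    exact mul_inv_cancel₀ (hpos t).ne'
  · refine norm_cfc_le zero_le_one fun t _ => ?_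
    rw [Real.norm_of_nonneg (inv_nonneg.2 (hpos t).le)]
    exact inv_le_one_of_one_le₀ (by nlinarith [sq_nonneg t])
  · rw [← em]
    refine norm_cfc_le zero_le_one fun t _ => ?_
    rw [Real.norm_eq_abs, abs_div, abs_of_pos (hpos t), div_le_one (hpos t)]
    nlinarith [sq_nonneg (|t| - 1), sq_abs t]

/-- The function `t ↦ t / (1 + t²)` is Lipschitz for the 2-norm. -/
lemma traceNorm_cfc_sub_le {τ : A →ₗ[ℂ] ℂ} (hτ : IsTracialState τ) {b h : A}
    (hb : IsSelfAdjoint b) (hh : IsSelfAdjoint h) :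
    traceNorm τ (cfc (fun t : ℝ => t / (1 + t ^ 2)) b - cfc (fun t : ℝ => t / (1 + t ^ 2)) h)
      ≤ 2 * traceNorm τ (b - h) := by
  obtain ⟨r, hr1, hr2, hr3, hr4, hr5, hr6⟩ := exists_resolvent hb
  obtain ⟨s, hs1, hs2, hs3, hs4, hs5, hs6⟩ := exists_resolvent hh
  have e : r * b - s * h = r * ((b - h) * s) + (r * b) * ((h - b) * (s * h)) := by
    calc r * b - s * h = r * b * ((1 + h * h) * s) - (r * (1 + b * b)) * (h * s) := by
          rw [hs2, hr1, mul_one, one_mul, hs3]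
      _ = _ := by rw [hs3]; noncomm_ring
  rw [hr4, hs4, e]
  refine (hτ.traceNorm_add_le _ _).trans ?_
  have hn := traceNorm_nonneg τ (b - h)
  have h1 : traceNorm τ (r * ((b - h) * s)) ≤ traceNorm τ (b - h) :=
    calc _ ≤ ‖r‖ * (traceNorm τ (b - h) * ‖s‖) := (hτ.traceNorm_mul_le _ _).trans
          (mul_le_mul_of_nonneg_left (hτ.traceNorm_mul_le' _ _) (norm_nonneg _))
      _ ≤ 1 * (traceNorm τ (b - h) * 1) := by gcongr
      _ = _ := by ring
  have h2 : traceNorm τ ((r * b) * ((h - b) * (s * h))) ≤ traceNorm τ (b - h) :=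
    calc _ ≤ ‖r * b‖ * (traceNorm τ (h - b) * ‖s * h‖) := (hτ.traceNorm_mul_le _ _).trans
          (mul_le_mul_of_nonneg_left (hτ.traceNorm_mul_le' _ _) (norm_nonneg _))
      _ ≤ 1 * (traceNorm τ (h - b) * 1) := by
          have := traceNorm_nonneg τ (h - b)
          gcongr
      _ = _ := by rw [traceNorm_sub_comm]; ring
  linarith

/-- A self-adjoint `a` with `‖a‖ ≤ 1/2` is of the form `h (1 + h²)⁻¹`, since the function
`t ↦ 2t / (1 + √(1 - 4t²))` is a right inverse of `t ↦ t / (1 + t²)` on `[-1/2, 1/2]`. -/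
lemma exists_cfc_eq {a : A} (ha : IsSelfAdjoint a) (hn : ‖a‖ ≤ 1 / 2) :
    ∃ h : A, IsSelfAdjoint h ∧ cfc (fun t : ℝ => t / (1 + t ^ 2)) h = a := by
  have hden : ∀ t : ℝ, 0 < 1 + √(1 - 4 * t ^ 2) := fun t => by positivity
  have hg : Continuous fun t : ℝ => 2 * t / (1 + √(1 - 4 * t ^ 2)) :=
    Continuous.div (by fun_prop) (by fun_prop) fun t => (hden t).ne'
  have hf : Continuous fun t : ℝ => t / (1 + t ^ 2) :=
    Continuous.div (by fun_prop) (by fun_prop) fun t => by positivity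
  refine ⟨cfc (fun t : ℝ => 2 * t / (1 + √(1 - 4 * t ^ 2))) a, cfc_predicate _ _, ?_⟩
  rw [← cfc_comp' (fun t : ℝ => t / (1 + t ^ 2)) (fun t : ℝ => 2 * t / (1 + √(1 - 4 * t ^ 2))) a
    hf.continuousOn hg.continuousOn]
  conv_rhs => rw [← cfc_id' ℝ a]
  refine cfc_congr fun t ht => ?_
  have ht' : |t| ≤ 1 / 2 := by
    rcases subsingleton_or_nontrivial A with h | h
    · simp [spectrum.of_subsingleton] at ht
    · exact (spectrum.norm_le_norm_of_mem ht).trans hn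
  have h0 : 0 ≤ 1 - 4 * t ^ 2 := by nlinarith [sq_abs t, abs_nonneg t]
  have hs := Real.sq_sqrt h0
  have hd := hden t
  set s := √(1 - 4 * t ^ 2)
  have e : (1 + s) ^ 2 + (2 * t) ^ 2 = 2 * (1 + s) := by nlinarith
  have e2 : (1 : ℝ) + (2 * t / (1 + s)) ^ 2 = 2 / (1 + s) := by
    field_simp
    linarith
  simp only [e2]
  field_simp

/-- Write `a = f(h)` with `f(t) = t / (1 + t²)`, approximate `h` in 2-norm by a self-adjoint
`⋆`-polynomial `q`, without control of its norm, and `f` by a real polynomial `g` on an interval that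
contains the spectra of all values of `q`. Then `g(q)` approximates `a` and is bounded by `1`. -/
lemma exists_bounded_poly_of_isSelfAdjoint {τ : A →ₗ[ℂ] ℂ} (hτ : IsTracialState τ) {n : ℕ}
    {y : Fin n → A} (hy : IsTraceDense τ y) {a : A} (ha : IsSelfAdjoint a) (hn : ‖a‖ ≤ 1 / 2)
    (R δ : ℝ) (hδ : 0 < δ) :
    ∃ P : NCPoly n, traceNorm τ (P.eval y - a) < δ ∧ ‖P.eval y‖ ≤ 1 ∧
      ∀ k, ∀ B : MatTuple n k, (∀ j, ‖B j‖ ≤ R) → ‖P.eval B‖ ≤ 1 := by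
  obtain ⟨h, hh, rfl⟩ := exists_cfc_eq ha hn
  obtain ⟨Q, hQ⟩ := hy h (δ / 8) (by positivity)
  obtain ⟨R', hR'⟩ : ∃ R', R ≤ R' ∧ ∀ j, ‖y j‖ ≤ R' := by
    refine ⟨|R| + ∑ j, ‖y j‖, ?_, fun j => ?_⟩
    · exact (le_abs_self R).trans (le_add_of_nonneg_right (Finset.sum_nonneg fun _ _ => norm_nonneg _))
    · exact (Finset.single_le_sum (fun i _ => norm_nonneg (y i)) (Finset.mem_univ j)).trans
        (le_add_of_nonneg_left (abs_nonneg R))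
  set K := Q.realPart.bound R'
  have hf : Continuous fun t : ℝ => t / (1 + t ^ 2) :=
    Continuous.div (by fun_prop) (by fun_prop) fun t => by positivity
  obtain ⟨g, hg⟩ := exists_polynomial_near_of_continuousOn (-K) K (fun t => t / (1 + t ^ 2))
    hf.continuousOn (min (1 / 2) (δ / 4)) (by positivity)
  have hg1 : ∀ t, |t| ≤ K → |g.eval t| ≤ 1 := by
    intro t ht
    have h1 := (hg t (abs_le.1 ht)).trans_le (min_le_left _ _)
    have h2 : |t / (1 + t ^ 2)| ≤ 1 / 2 := by
      have : 0 < 1 + t ^ 2 := by positivity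
      rw [abs_div, abs_of_pos this, div_le_iff₀ this]
      nlinarith [sq_nonneg (|t| - 1), sq_abs t]
    have := abs_sub_abs_le_abs_sub (g.eval t) (t / (1 + t ^ 2))
    linarith
  refine ⟨Q.realPart.applyPolynomial g, ?_,
    Q.norm_eval_applyPolynomial_le hR'.2 g zero_le_one hg1, fun k B hB =>
    Q.norm_eval_applyPolynomial_le (fun j => (hB j).trans hR'.1) g zero_le_one hg1⟩
  have hsa := Q.isSelfAdjoint_eval_realPart y
  set b := Q.realPart.eval y with hb
  have hbh : traceNorm τ (b - h) ≤ δ / 8 := by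
    have e : b - h = (1 / 2 : ℂ) • (Q.eval y - h) + (1 / 2 : ℂ) • star (Q.eval y - h) := by
      rw [star_sub, hh.star_eq, hb]
      simp only [NCPoly.realPart, NCPoly.eval_mul, NCPoly.eval_const, NCPoly.eval_add,
        NCPoly.eval_adj, ← Algebra.smul_def]
      module
    rw [e]
    refine (hτ.traceNorm_add_le _ _).trans ?_
    rw [traceNorm_smul, traceNorm_smul, hτ.traceNorm_star]
    norm_num
    linarith
  have h1 : ‖Polynomial.aeval b g - cfc (fun t : ℝ => t / (1 + t ^ 2)) b‖ ≤ δ / 4 := by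
    rw [← cfc_polynomial g b hsa, ← cfc_sub _ _ b (by fun_prop) hf.continuousOn]
    refine norm_cfc_le (by positivity) fun t ht => ?_
    have ht' : |t| ≤ K := by
      rcases subsingleton_or_nontrivial A with h | h
      · simp [spectrum.of_subsingleton] at ht
      · exact (spectrum.norm_le_norm_of_mem ht).trans (Q.realPart.norm_eval_le hR'.2)
    exact ((hg t (abs_le.1 ht')).trans_le (min_le_right _ _)).le
  rw [NCPoly.eval_applyPolynomial, ← hb]
  have h2 := traceNorm_cfc_sub_le hτ hsa hh
  have h3 := hτ.traceNorm_sub_le (Polynomial.aeval b g) (cfc (fun t : ℝ => t / (1 + t ^ 2)) b)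
    (cfc (fun t : ℝ => t / (1 + t ^ 2)) h)
  have h4 := hτ.traceNorm_le_norm (Polynomial.aeval b g - cfc (fun t : ℝ => t / (1 + t ^ 2)) b)
  linarith

lemma norm_smul_add_smul_I_le {E : Type*} [SeminormedAddCommGroup E] [NormedSpace ℂ E] {c : ℝ}
    (hc : 0 ≤ c) {p q : E} (hp : ‖p‖ ≤ 1) (hq : ‖q‖ ≤ 1) :
    ‖(c : ℂ) • p + (c * Complex.I : ℂ) • q‖ ≤ c * 1 + c * 1 := by
  refine (norm_add_le _ _).trans ?_
  rw [norm_smul, norm_smul, norm_mul, Complex.norm_I, mul_one, Complex.norm_real,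
    Real.norm_of_nonneg hc]
  gcongr

/-- A Kaplansky-type density statement. Every element `a` is a limit in 2-norm of values of
`⋆`-polynomials whose norms are bounded by a constant that depends on `a` only, both at `y` and at
the matrix tuples of all sizes with norms at most `R`. -/
lemma exists_bounded_poly {τ : A →ₗ[ℂ] ℂ} (hτ : IsTracialState τ) {n : ℕ}
    {y : Fin n → A} (hy : IsTraceDense τ y) (a : A) :
    ∃ C : ℝ, ∀ R δ : ℝ, 0 < δ →
    ∃ P : NCPoly n, traceNorm τ (P.eval y - a) < δ ∧ ‖P.eval y‖ ≤ C ∧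
      ∀ k, ∀ B : MatTuple n k, (∀ j, ‖B j‖ ≤ R) → ‖P.eval B‖ ≤ C := by
  set c : ℝ := 2 * (‖a‖ + 1)
  have hc : 0 < c := by positivity
  have hcc : (c : ℂ) ≠ 0 := by exact_mod_cast hc.ne'
  set a₁ : A := (c : ℂ)⁻¹ • (realPart a : A)
  set a₂ : A := (c : ℂ)⁻¹ • (imaginaryPart a : A)
  have hb : ∀ z : selfAdjoint A, ‖(z : A)‖ ≤ ‖a‖ → IsSelfAdjoint ((c : ℂ)⁻¹ • (z : A)) ∧
      ‖(c : ℂ)⁻¹ • (z : A)‖ ≤ 1 / 2 := by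
    intro z hz
    constructor
    · rw [isSelfAdjoint_iff, star_smul, z.2.star_eq]
      simp
    · rw [norm_smul, norm_inv, Complex.norm_real, Real.norm_of_nonneg hc.le, inv_mul_le_iff₀ hc]
      simp only [c]
      linarith
  obtain ⟨h1, h1'⟩ := hb (realPart a) (realPart.norm_le a)
  obtain ⟨h2, h2'⟩ := hb (imaginaryPart a) (imaginaryPart.norm_le a)
  refine ⟨c * 1 + c * 1, fun R δ hδ => ?_⟩
  obtain ⟨P, hP, hP1, hP2⟩ := exists_bounded_poly_of_isSelfAdjoint hτ hy h1 h1' R (δ / (2 * c))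
    (by positivity)
  obtain ⟨Q, hQ, hQ1, hQ2⟩ := exists_bounded_poly_of_isSelfAdjoint hτ hy h2 h2' R (δ / (2 * c))
    (by positivity)
  refine ⟨.add (.mul (.const c) P) (.mul (.const (c * Complex.I)) Q), ?_, ?_, ?_⟩
  · have e : (NCPoly.add (.mul (.const c) P) (.mul (.const (c * Complex.I)) Q)).eval y - a
        = (c : ℂ) • (P.eval y - a₁) + (c * Complex.I : ℂ) • (Q.eval y - a₂) := by
      conv_lhs => rw [← realPart_add_I_smul_imaginaryPart a]
      simp only [NCPoly.eval_mul, NCPoly.eval_const, NCPoly.eval_add, ← Algebra.smul_def, a₁, a₂,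
        smul_sub, smul_smul]
      rw [mul_inv_cancel₀ hcc, mul_right_comm, mul_inv_cancel₀ hcc]
      module
    rw [e]
    refine (hτ.traceNorm_add_le _ _).trans_lt ?_
    rw [traceNorm_smul, traceNorm_smul, norm_mul, Complex.norm_I, mul_one, Complex.norm_real,
      Real.norm_of_nonneg hc.le]
    have hP' := mul_lt_mul_of_pos_left hP hc
    have hQ' := mul_lt_mul_of_pos_left hQ hc
    have e2 : c * (δ / (2 * c)) = δ / 2 := by field_simp
    linarith
  · rw [NCPoly.eval_add, NCPoly.eval_mul, NCPoly.eval_mul, NCPoly.eval_const, NCPoly.eval_const,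
      ← Algebra.smul_def, ← Algebra.smul_def]
    exact norm_smul_add_smul_I_le hc.le hP1 hQ1
  · intro k B hB
    rw [NCPoly.eval_add, NCPoly.eval_mul, NCPoly.eval_mul, NCPoly.eval_const, NCPoly.eval_const,
      ← Algebra.smul_def, ← Algebra.smul_def]
    exact norm_smul_add_smul_I_le hc.le (hP2 k B hB) (hQ2 k B hB)

end CStar

/-! ### The density theorem for von Neumann algebras with a normal tracial state -/

section Amplification

variable {H : Type*} [NormedAddCommGroup H] [InnerProductSpace ℂ H]

/-- The Hilbert space `ℓ²(ℕ, H)` of square-summable sequences in `H`. -/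
abbrev SeqSpace (H : Type*) [NormedAddCommGroup H] [InnerProductSpace ℂ H] : Type _ :=
  lp (fun _ : ℕ => H) 2

lemma memℓp_comp (a : H →L[ℂ] H) (f : SeqSpace H) : Memℓp (fun i => a (f i)) 2 := by
  refine memℓp_gen ?_
  have h := (lp.memℓp f).summable (by norm_num)
  simp only [ENNReal.toReal_ofNat, Real.rpow_two] at h ⊢
  refine Summable.of_nonneg_of_le (fun _ => by positivity) (fun i => ?_) (h.mul_left (‖a‖ ^ 2))
  rw [← mul_pow]
  gcongr
  exact a.le_opNorm _

lemma hasSum_norm_sq (f : SeqSpace H) : HasSum (fun i => ‖f i‖ ^ 2) (‖f‖ ^ 2) := by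
  have h := (Complex.hasSum_re (lp.hasSum_inner (𝕜 := ℂ) f f))
  have e₁ : ∀ v : H, (inner ℂ v v).re = ‖v‖ ^ 2 := inner_self_eq_norm_sq (𝕜 := ℂ)
  have e₂ : ∀ v : SeqSpace H, (inner ℂ v v).re = ‖v‖ ^ 2 := inner_self_eq_norm_sq (𝕜 := ℂ)
  simpa only [e₁, e₂] using h

/-- The amplification of an operator on `H` to `ℓ²(ℕ, H)`, acting on each coordinate. -/
def amplify (a : H →L[ℂ] H) : SeqSpace H →L[ℂ] SeqSpace H :=
  LinearMap.mkContinuous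
    { toFun := fun f => ⟨fun i => a (f i), memℓp_comp a f⟩
      map_add' := fun f g => by ext i; exact map_add a _ _
      map_smul' := fun c f => by ext i; simp } ‖a‖ fun f => by
    refine le_of_sq_le_sq ?_ (by positivity)
    rw [mul_pow]
    refine hasSum_le (fun i => ?_) (hasSum_norm_sq _) ((hasSum_norm_sq f).mul_left (‖a‖ ^ 2))
    rw [← mul_pow]
    gcongr
    exact a.le_opNorm _

@[simp] lemma amplify_apply (a : H →L[ℂ] H) (f : SeqSpace H) (i : ℕ) :
    amplify a f i = a (f i) := rfl

variable [CompleteSpace H]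

lemma inner_amplify (a : H →L[ℂ] H) (f g : SeqSpace H) :
    inner ℂ f (amplify a g) = inner ℂ (amplify (star a) f) g := by
  rw [lp.inner_eq_tsum, lp.inner_eq_tsum]
  congr 1
  ext i
  rw [amplify_apply, amplify_apply, ContinuousLinearMap.star_eq_adjoint,
    ContinuousLinearMap.adjoint_inner_left]

/-- The orthogonal projection onto a closed subspace commutes with an operator `T` if the subspace
is invariant under `T` and under the adjoint `T'` of `T`. -/
lemma starProjection_comm {E : Type*} [NormedAddCommGroup E] [InnerProductSpace ℂ E]
    (K : Submodule ℂ E) [K.HasOrthogonalProjection] (T T' : E →L[ℂ] E)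
    (hadj : ∀ f g, inner ℂ f (T g) = inner ℂ (T' f) g)
    (hT : ∀ f ∈ K, T f ∈ K) (hT' : ∀ f ∈ K, T' f ∈ K) (f : E) :
    K.starProjection (T f) = T (K.starProjection f) := by
  refine Submodule.eq_starProjection_of_mem_orthogonal (hT _ (K.starProjection_apply_mem f)) ?_
  rw [← map_sub, Submodule.mem_orthogonal]
  intro g hg
  rw [hadj]
  exact Submodule.inner_right_of_mem_orthogonal (hT' g hg) (K.sub_starProjection_mem_orthogonal f)

/-- A form of the double commutant theorem. An operator in the double commutant of a
`⋆`-subalgebra `D` is approximated by elements of `D` on any square-summable sequence of vectors.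
The amplification to `ℓ²(ℕ, H)` turns the sequence into one vector `ξ`, and the matrix entries of
the projection onto the closure of `D ξ` lie in the commutant of `D`. -/
lemma exists_norm_amplify_sub_lt (D : StarSubalgebra ℂ (H →L[ℂ] H)) {b : H →L[ℂ] H}
    (hb : b ∈ Set.centralizer (Set.centralizer (D : Set (H →L[ℂ] H)))) (ξ : SeqSpace H) {δ : ℝ}
    (hδ : 0 < δ) : ∃ d ∈ D, ‖amplify d ξ - amplify b ξ‖ < δ := by
  let L : (H →L[ℂ] H) →ₗ[ℂ] SeqSpace H :=
    { toFun := fun a => amplify a ξ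
      map_add' := fun a c => by ext i; simp
      map_smul' := fun c a => by ext i; simp }
  let K₀ : Submodule ℂ (SeqSpace H) := (Subalgebra.toSubmodule D.toSubalgebra).map L
  let K := K₀.topologicalClosure
  have : CompleteSpace K := K₀.isClosed_topologicalClosure.completeSpace_coe
  have hinv : ∀ s ∈ D, ∀ f ∈ K, amplify s f ∈ K := by
    intro s hs f hf
    refine map_mem_closure (amplify s).continuous hf ?_
    rintro _ ⟨a, ha, rfl⟩
    exact ⟨s * a, D.mul_mem hs ha, by ext i; rfl⟩
  have hcomm : ∀ s ∈ D, ∀ f, K.starProjection (amplify s f) = amplify s (K.starProjection f) :=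
    fun s hs => starProjection_comm K _ _ (inner_amplify s) (hinv s hs) (hinv _ (star_mem hs))
  let entry : ℕ → ℕ → H →L[ℂ] H := fun i j =>
    (lp.evalCLM ℂ (fun _ : ℕ => H) 2 i).comp
      (K.starProjection.comp (lp.singleContinuousLinearMap ℂ (fun _ : ℕ => H) 2 j))
  have hentry : ∀ i j (v : H), entry i j v = K.starProjection (lp.single 2 j v) i :=
    fun i j v => rfl
  have hsingle : ∀ (a : H →L[ℂ] H) (j : ℕ) (v : H),
      amplify a (lp.single 2 j v) = lp.single 2 j (a v) := by
    intro a j v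
    ext i
    rw [amplify_apply]
    by_cases h : i = j
    · subst h; simp
    · simp [h]
  have hmem : ∀ i j, entry i j ∈ Set.centralizer (D : Set (H →L[ℂ] H)) := by
    intro i j s hs
    ext v
    change s (entry i j v) = entry i j (s v)
    rw [hentry, hentry, ← hsingle, hcomm s hs, amplify_apply]
  have hbe : ∀ i j v, entry i j (b v) = b (entry i j v) := by
    intro i j v
    exact congrArg (fun T : H →L[ℂ] H => T v) (hb _ (hmem i j))
  have hexp : ∀ (f : SeqSpace H) (i : ℕ),
      HasSum (fun j => entry i j (f j)) (K.starProjection f i) := by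
    intro f i
    exact (lp.hasSum_single (p := 2) (by norm_num) f).mapL
      ((lp.evalCLM ℂ (fun _ : ℕ => H) 2 i).comp K.starProjection)
  have hξ : ξ ∈ K := by
    refine subset_closure ⟨1, one_mem D, ?_⟩
    ext i
    rfl
  have hbξ : amplify b ξ ∈ K := by
    rw [← Submodule.starProjection_eq_self_iff]
    ext i
    have h1 := hexp (amplify b ξ) i
    have h2 := (hexp ξ i).mapL b
    simp only [amplify_apply, hbe] at h1
    rw [h1.unique h2, Submodule.starProjection_eq_self_iff.2 hξ, amplify_apply]
  obtain ⟨_, ⟨d, hd, rfl⟩, hdist⟩ := Metric.mem_closure_iff.1 hbξ δ hδ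
  refine ⟨d, hd, ?_⟩
  rw [dist_comm, dist_eq_norm] at hdist
  exact hdist

end Amplification

section VonNeumann

variable {H : Type*} [NormedAddCommGroup H] [InnerProductSpace ℂ H] [CompleteSpace H]

lemma IsNormalTracialState.isTracialState {M : VonNeumannAlgebra H}
    {τ : M.toStarSubalgebra →ₗ[ℂ] ℂ} (hτ : IsNormalTracialState M τ) : IsTracialState τ :=
  ⟨hτ.map_one, hτ.nonneg, hτ.tracial⟩

lemma isClosed_vonNeumannAlgebra (M : VonNeumannAlgebra H) :
    IsClosed (M.toStarSubalgebra : Set (H →L[ℂ] H)) := by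
  rw [VonNeumannAlgebra.coe_toStarSubalgebra, ← M.centralizer_centralizer]
  exact Set.isClosed_centralizer _

lemma exists_eval_eq_of_mem_adjoin {A : Type*} [Ring A] [StarRing A] [Algebra ℂ A]
    [StarModule ℂ A] {n : ℕ} (x : Fin n → A) {a : A} (ha : a ∈ StarAlgebra.adjoin ℂ (Set.range x)) :
    ∃ P : NCPoly n, P.eval x = a := by
  induction ha using StarAlgebra.adjoin_induction with
  | mem a h =>
    obtain ⟨i, rfl⟩ := h
    exact ⟨.var i, rfl⟩
  | algebraMap r => exact ⟨.const r, rfl⟩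
  | add a b _ _ h1 h2 =>
    obtain ⟨⟨P, rfl⟩, ⟨Q, rfl⟩⟩ := And.intro h1 h2
    exact ⟨.add P Q, rfl⟩
  | mul a b _ _ h1 h2 =>
    obtain ⟨⟨P, rfl⟩, ⟨Q, rfl⟩⟩ := And.intro h1 h2
    exact ⟨.mul P Q, rfl⟩
  | star a _ h =>
    obtain ⟨P, rfl⟩ := h
    exact ⟨.adj P, rfl⟩

lemma IsNormalTracialState.hasSum_traceNorm_sq {M : VonNeumannAlgebra H}
    {τ : M.toStarSubalgebra →ₗ[ℂ] ℂ} (hτ : IsNormalTracialState M τ) {ξ : ℕ → H}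
    (hξ : ∀ a : M.toStarSubalgebra, HasSum (fun i => inner ℂ (ξ i) ((a : H →L[ℂ] H) (ξ i))) (τ a))
    (a : M.toStarSubalgebra) :
    HasSum (fun i => ‖(a : H →L[ℂ] H) (ξ i)‖ ^ 2) (traceNorm τ a ^ 2) := by
  rw [hτ.isTracialState.sq_traceNorm]
  convert Complex.hasSum_re (hξ (star a * a)) using 2 with i
  change _ = (inner ℂ (ξ i) ((star (a : H →L[ℂ] H)) ((a : H →L[ℂ] H) (ξ i)))).re
  rw [ContinuousLinearMap.star_eq_adjoint, ContinuousLinearMap.adjoint_inner_right,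
    inner_self_eq_norm_sq_to_K]
  norm_cast

/-- The `⋆`-polynomials in a generating tuple of a von Neumann algebra are dense in 2-norm. -/
lemma IsNormalTracialState.isTraceDense {M : VonNeumannAlgebra H}
    {τ : M.toStarSubalgebra →ₗ[ℂ] ℂ} (hτ : IsNormalTracialState M τ) {n : ℕ}
    {x : Fin n → M.toStarSubalgebra}
    (hx : Generates (Set.range fun i => (x i : H →L[ℂ] H)) M) : IsTraceDense τ x := by
  intro a δ hδ
  obtain ⟨ξ, hξ1, hξ2⟩ := hτ.normal
  set x' : Fin n → H →L[ℂ] H := fun i => (x i : H →L[ℂ] H)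
  have hmem : Memℓp ξ 2 := memℓp_gen (by simpa using hξ1)
  have ha : (a : H →L[ℂ] H) ∈ Set.centralizer (Set.centralizer
      (StarAlgebra.adjoin ℂ (Set.range x') : Set (H →L[ℂ] H))) := by
    have h1 : (a : H →L[ℂ] H) ∈ Set.centralizer (Set.centralizer
        (Set.range x' ∪ star (Set.range x'))) := by
      rw [hx]
      exact a.2
    refine Set.centralizer_subset (Set.centralizer_subset ?_) h1
    exact Algebra.subset_adjoin
  obtain ⟨d, hd, hdist⟩ := exists_norm_amplify_sub_lt _ ha ⟨ξ, hmem⟩ hδ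
  obtain ⟨P, rfl⟩ := exists_eval_eq_of_mem_adjoin x' hd
  refine ⟨P, lt_of_pow_lt_pow_left₀ 2 hδ.le (lt_of_le_of_lt (le_of_eq ?_)
    (pow_lt_pow_left₀ hdist (norm_nonneg _) two_ne_zero))⟩
  refine (hτ.hasSum_traceNorm_sq hξ2 _).unique ?_
  convert hasSum_norm_sq _ using 3 with i
  have e : ((P.eval x : M.toStarSubalgebra) : H →L[ℂ] H) = P.eval x' :=
    P.map_eval M.toStarSubalgebra.subtype x
  change ‖(((P.eval x : M.toStarSubalgebra) : H →L[ℂ] H) - (a : H →L[ℂ] H)) (ξ i)‖ = _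
  rw [e]
  rfl

end VonNeumann

/-! ### Covering the approximate fixed points of an operator of small Hilbert–Schmidt norm -/

section Net

open MeasureTheory Metric Module in
/-- The volume bound for separated sets in a ball. -/
lemma card_le_of_separated {E : Type*} [NormedAddCommGroup E] [NormedSpace ℝ E]
    [FiniteDimensional ℝ E] {ρ r : ℝ} (hρ : 0 ≤ ρ) (hr : 0 < r) (s : Finset E)
    (hs : ∀ c ∈ s, ‖c‖ ≤ ρ) (h : ∀ c ∈ s, ∀ d ∈ s, c ≠ d → r ≤ ‖c - d‖) :
    (s.card : ℝ) ≤ (1 + 2 * ρ / r) ^ finrank ℝ E := by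
  borelize E
  let μ : Measure E := Measure.addHaar
  have hr2 : 0 < r / 2 := by positivity
  have hρr : 0 < ρ + r / 2 := by positivity
  have hdisj : Set.PairwiseDisjoint (s : Set E) fun c => ball c (r / 2) := by
    intro c hc d hd hcd
    apply ball_disjoint_ball
    rw [dist_eq_norm, add_halves]
    exact h c hc d hd hcd
  have hsub : (⋃ c ∈ s, ball c (r / 2)) ⊆ ball (0 : E) (ρ + r / 2) := by
    refine Set.iUnion₂_subset fun c hc => ball_subset_ball' ?_
    rw [dist_zero_right, add_comm]
    exact add_le_add_left (hs c hc) _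
  have h1 : (s.card : ℝ≥0∞) * ENNReal.ofReal ((r / 2) ^ finrank ℝ E) * μ (ball 0 1) ≤
      ENNReal.ofReal ((ρ + r / 2) ^ finrank ℝ E) * μ (ball 0 1) :=
    calc _ = μ (⋃ c ∈ s, ball c (r / 2)) := by
          rw [measure_biUnion_finset hdisj fun c _ => measurableSet_ball]
          simp only [μ.addHaar_ball_of_pos _ hr2, Finset.sum_const, nsmul_eq_mul, mul_assoc]
      _ ≤ μ (ball (0 : E) (ρ + r / 2)) := measure_mono hsub
      _ = _ := by rw [μ.addHaar_ball_of_pos _ hρr]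
  have h2 : (s.card : ℝ≥0∞) * ENNReal.ofReal ((r / 2) ^ finrank ℝ E) ≤
      ENNReal.ofReal ((ρ + r / 2) ^ finrank ℝ E) :=
    (ENNReal.mul_le_mul_iff_left (measure_ball_pos _ _ zero_lt_one).ne' measure_ball_lt_top.ne).1 h1
  have h3 := ENNReal.toReal_le_of_le_ofReal (by positivity) h2
  rw [ENNReal.toReal_mul, ENNReal.toReal_natCast, ENNReal.toReal_ofReal (by positivity),
    ← le_div_iff₀ (by positivity), ← div_pow] at h3
  have e : (ρ + r / 2) / (r / 2) = 1 + 2 * ρ / r := by field_simp; ring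
  rwa [e] at h3

open Module in
/-- A ball of radius `ρ` in a real normed space of dimension `d` has an `r`-net with at most
`(1 + 2ρ/r)^d` points. -/
lemma exists_net {E : Type*} [NormedAddCommGroup E] [NormedSpace ℝ E]
    [FiniteDimensional ℝ E] {ρ r : ℝ} (hρ : 0 ≤ ρ) (hr : 0 < r) :
    ∃ s : Finset E, (s.card : ℝ) ≤ (1 + 2 * ρ / r) ^ finrank ℝ E ∧
      ∀ v : E, ‖v‖ ≤ ρ → ∃ c ∈ s, ‖v - c‖ < r := by
  classical
  let sep : Finset E → Prop := fun s =>
    (∀ c ∈ s, ‖c‖ ≤ ρ) ∧ ∀ c ∈ s, ∀ d ∈ s, c ≠ d → r ≤ ‖c - d‖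
  let cards : Set ℕ := {m | ∃ s, sep s ∧ s.card = m}
  have hbdd : BddAbove cards := by
    refine ⟨⌈(1 + 2 * ρ / r) ^ finrank ℝ E⌉₊, ?_⟩
    rintro _ ⟨s, hs, rfl⟩
    exact_mod_cast (card_le_of_separated hρ hr s hs.1 hs.2).trans (Nat.le_ceil _)
  obtain ⟨s, hs, hcard⟩ : sSup cards ∈ cards :=
    Nat.sSup_mem ⟨0, ∅, ⟨by simp, by simp⟩, rfl⟩ hbdd
  refine ⟨s, card_le_of_separated hρ hr s hs.1 hs.2, fun v hv => ?_⟩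
  by_contra! hfar
  have hvs : v ∉ s := fun h => by
    have := hfar v h
    simp only [sub_self, norm_zero] at this
    linarith
  have hins : sep (insert v s) := by
    refine ⟨?_, ?_⟩
    · intro c hc
      rcases Finset.mem_insert.1 hc with rfl | hc
      exacts [hv, hs.1 c hc]
    · intro c hc d hd hcd
      rcases Finset.mem_insert.1 hc with rfl | hc' <;>
        rcases Finset.mem_insert.1 hd with rfl | hd'
      · exact absurd rfl hcd
      · exact hfar d hd'
      · rw [norm_sub_rev]
        exact hfar c hc'
      · exact hs.2 c hc' d hd' hcd
  have := le_csSup hbdd (⟨_, hins, rfl⟩ : (insert v s).card ∈ cards)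
  rw [Finset.card_insert_of_notMem hvs, hcard] at this
  omega

variable {E : Type*} [NormedAddCommGroup E] [InnerProductSpace ℂ E] [FiniteDimensional ℂ E]

/-- The Hilbert–Schmidt norm, computed in an orthonormal basis, dominates the sum over every
orthonormal family. -/
lemma sum_norm_sq_map_le {ι : Type*} [Fintype ι] (b : OrthonormalBasis ι ℂ E) (T : E →ₗ[ℂ] E)
    (u : Finset E) (hu : Orthonormal ℂ ((↑) : u → E)) :
    ∑ e ∈ u, ‖T e‖ ^ 2 ≤ ∑ i, ‖T (b i)‖ ^ 2 := by
  have hT : ∀ i e, ‖inner ℂ (b i) (T e)‖ = ‖inner ℂ e (T.adjoint (b i))‖ := fun i e => by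
    rw [LinearMap.adjoint_inner_right, norm_inner_symm]
  calc ∑ e ∈ u, ‖T e‖ ^ 2 = ∑ e ∈ u, ∑ i, ‖inner ℂ e (T.adjoint (b i))‖ ^ 2 := by
        refine Finset.sum_congr rfl fun e _ => ?_
        rw [← b.sum_sq_norm_inner_right (T e)]
        simp only [hT]
    _ = ∑ i, ∑ e ∈ u, ‖inner ℂ e (T.adjoint (b i))‖ ^ 2 := Finset.sum_comm
    _ ≤ ∑ i, ‖T.adjoint (b i)‖ ^ 2 := by
        refine Finset.sum_le_sum fun i _ => ?_
        rw [← Finset.sum_coe_sort]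
        exact hu.sum_inner_products_le (s := Finset.univ) (T.adjoint (b i))
    _ = ∑ i, ∑ j, ‖inner ℂ (b j) (T.adjoint (b i))‖ ^ 2 := by
        refine Finset.sum_congr rfl fun i _ => (b.sum_sq_norm_inner_right _).symm
    _ = ∑ j, ∑ i, ‖inner ℂ (b i) (T (b j))‖ ^ 2 := by
        rw [Finset.sum_comm]
        simp only [hT]
    _ = ∑ j, ‖T (b j)‖ ^ 2 := Finset.sum_congr rfl fun j _ => b.sum_sq_norm_inner_right _

/-- Outside a subspace of dimension at most `h / s²`, an operator with squared Hilbert–Schmidt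
norm `h` has norm at most `s`: the subspace is spanned by a maximal orthonormal family of vectors
that are not shrunk below `s`. -/
lemma exists_submodule_norm_map_le {ι : Type*} [Fintype ι] (b : OrthonormalBasis ι ℂ E)
    (T : E →ₗ[ℂ] E) {h s : ℝ} (hT : ∑ i, ‖T (b i)‖ ^ 2 ≤ h) (hs : 0 < s) :
    ∃ F : Submodule ℂ E, (Module.finrank ℂ F : ℝ) ≤ h / s ^ 2 ∧ ∀ x ∈ Fᗮ, ‖T x‖ ≤ s * ‖x‖ := by
  classical
  -- Orthonormal families of vectors not shrunk below `s`; their cardinalities are bounded.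
  let good : Finset E → Prop := fun u =>
    Orthonormal ℂ ((↑) : u → E) ∧ ∀ e ∈ u, s ≤ ‖T e‖
  have hcard : ∀ u, good u → (u.card : ℝ) ≤ h / s ^ 2 := by
    intro u hu
    rw [le_div_iff₀ (by positivity), ← nsmul_eq_mul, ← Finset.sum_const]
    refine le_trans (Finset.sum_le_sum fun e he => ?_) ((sum_norm_sq_map_le b T u hu.1).trans hT)
    exact pow_le_pow_left₀ hs.le (hu.2 e he) 2
  let cards : Set ℕ := {m | ∃ u, good u ∧ u.card = m}
  have hbdd : BddAbove cards := by
    refine ⟨⌈h / s ^ 2⌉₊, ?_⟩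
    rintro _ ⟨u, hu, rfl⟩
    exact_mod_cast (hcard u hu).trans (Nat.le_ceil _)
  have hempty : good ∅ := ⟨orthonormal_subtype_iff_ite.2 (by simp), by simp⟩
  obtain ⟨u, hu, hmax⟩ : sSup cards ∈ cards := Nat.sSup_mem ⟨0, ∅, hempty, rfl⟩ hbdd
  refine ⟨Submodule.span ℂ u, le_trans ?_ (hcard u hu), fun x hx => ?_⟩
  · exact_mod_cast finrank_span_finset_le_card u
  by_contra! hlt
  have hx0 : ‖x‖ ≠ 0 := by
    intro h0
    rw [norm_eq_zero] at h0
    simp [h0] at hlt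
  set y : E := ((‖x‖ : ℂ)⁻¹) • x
  have hy : ‖y‖ = 1 := by
    rw [norm_smul, norm_inv, Complex.norm_real, norm_norm, inv_mul_cancel₀ hx0]
  have hyT : s ≤ ‖T y‖ := by
    rw [map_smul, norm_smul, norm_inv, Complex.norm_real, norm_norm,
      le_inv_mul_iff₀ (lt_of_le_of_ne (norm_nonneg _) (Ne.symm hx0)), mul_comm]
    exact hlt.le
  have horth : ∀ e ∈ u, inner ℂ e y = 0 := fun e he =>
    Submodule.inner_right_of_mem_orthogonal (Submodule.subset_span he) (Submodule.smul_mem _ _ hx)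
  have hyy : inner ℂ y y = (1 : ℂ) := by rw [inner_self_eq_norm_sq_to_K, hy]; simp
  have hyu : y ∉ u := fun hmem =>
    one_ne_zero (hyy.symm.trans (horth y hmem))
  have hins : good (insert y u) := by
    refine ⟨?_, ?_⟩
    · have h0 := orthonormal_subtype_iff_ite.1 hu.1
      refine orthonormal_subtype_iff_ite.2 fun v hv w hw => ?_
      rcases Finset.mem_insert.1 hv with rfl | hv' <;>
        rcases Finset.mem_insert.1 hw with rfl | hw'
      · rw [hyy, if_pos rfl]
      · rw [if_neg (ne_of_mem_of_not_mem hw' hyu).symm, ← inner_conj_symm, horth w hw', map_zero]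
      · rw [if_neg (ne_of_mem_of_not_mem hv' hyu), horth v hv']
      · exact h0 v hv' w hw'
    · intro e he
      rcases Finset.mem_insert.1 he with rfl | he
      exacts [hyT, hu.2 e he]
  have := le_csSup hbdd (⟨_, hins, rfl⟩ : (insert y u).card ∈ cards)
  rw [Finset.card_insert_of_notMem hyu, hmax] at this
  omega

/-- The approximate fixed points of norm at most `S` of an operator with squared Hilbert–Schmidt
norm at most `h` are covered by few balls: they are close to the image of a subspace of dimension
at most `h S² / ρ²`. -/
lemma exists_net_approx_fixed {ι : Type*} [Fintype ι] (b : OrthonormalBasis ι ℂ E)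
    (T : E →ₗ[ℂ] E) {h S ρ : ℝ} (hT : ∑ i, ‖T (b i)‖ ^ 2 ≤ h) (hS : 0 < S) (hρ : 0 < ρ) :
    ∃ s : Finset E, (s.card : ℝ) ≤ (5 + 2 * S / ρ) ^ (2 * (h * S ^ 2 / ρ ^ 2)) ∧
      ∀ v, ‖v‖ ≤ S → ‖T v - v‖ ≤ ρ → ∃ c ∈ s, ‖v - c‖ ≤ 3 * ρ := by
  classical
  obtain ⟨F, hF1, hF2⟩ := exists_submodule_norm_map_le b T hT (div_pos hρ hS)
  let G := F.map T
  obtain ⟨s, hs1, hs2⟩ := exists_net (E := G) (ρ := S + 2 * ρ) (r := ρ) (by positivity) hρ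
  have hbase : 1 + 2 * (S + 2 * ρ) / ρ = 5 + 2 * S / ρ := by field_simp; ring
  have hdim : (Module.finrank ℝ G : ℝ) ≤ 2 * (h * S ^ 2 / ρ ^ 2) := by
    have h1 : Module.finrank ℝ G = 2 * Module.finrank ℂ G := finrank_real_of_complex G
    have h2 : (Module.finrank ℂ G : ℝ) ≤ Module.finrank ℂ F := by
      exact_mod_cast Submodule.finrank_map_le T F
    have h3 : h / (ρ / S) ^ 2 = h * S ^ 2 / ρ ^ 2 := by field_simp
    rw [h1]
    push_cast
    rw [h3] at hF1
    linarith
  refine ⟨s.image Subtype.val, ?_, fun v hv hTv => ?_⟩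
  · rw [Finset.card_image_of_injective _ Subtype.val_injective]
    refine hs1.trans ?_
    rw [hbase, ← Real.rpow_natCast]
    have : 0 ≤ 2 * S / ρ := by positivity
    exact Real.rpow_le_rpow_of_exponent_le (by linarith) hdim
  · set p := F.starProjection v
    have hp : v - p ∈ Fᗮ := F.sub_starProjection_mem_orthogonal v
    have h1 : ‖T (v - p)‖ ≤ ρ := by
      refine (hF2 _ hp).trans ?_
      have h2 : ‖v - p‖ ≤ S := by
        refine le_trans ?_ hv
        have h3 : v - p = Fᗮ.starProjection v := by
          rw [Submodule.starProjection_orthogonal_val]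
        rw [h3]
        exact Submodule.norm_starProjection_apply_le _ _
      calc ρ / S * ‖v - p‖ ≤ ρ / S * S := by gcongr
        _ = ρ := by field_simp
    have h2 : ‖v - T p‖ ≤ 2 * ρ := by
      have e : v - T p = T (v - p) - (T v - v) := by rw [map_sub]; abel
      rw [e]
      exact (norm_sub_le _ _).trans (by linarith)
    have h3 : ‖T p‖ ≤ S + 2 * ρ := by
      have e : T p = v - (v - T p) := by abel
      rw [e]
      exact (norm_sub_le _ _).trans (by linarith)
    obtain ⟨c, hc, hpc⟩ := hs2 ⟨T p, p, F.starProjection_apply_mem v, rfl⟩ h3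
    refine ⟨c, Finset.mem_image_of_mem _ hc, ?_⟩
    have e : v - c = (v - T p) + (T p - c) := by abel
    have h4 : ‖T p - c‖ < ρ := hpc
    rw [e]
    exact (norm_add_le _ _).trans (by linarith)

end Net

/-! ### The averaging operator of two almost Haar families of matrices -/

section Averaging

variable {k : ℕ}

/-- The entries of a matrix as a vector of a Hilbert space. -/
def vectorize (k : ℕ) : Matrix (Fin k) (Fin k) ℂ ≃ₗ[ℂ] EuclideanSpace ℂ (Fin k × Fin k) :=
  (LinearEquiv.curry ℂ ℂ (Fin k) (Fin k)).symm.trans (WithLp.linearEquiv 2 ℂ _).symm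

lemma vectorize_apply (A : Matrix (Fin k) (Fin k) ℂ) (p : Fin k × Fin k) :
    vectorize k A p = A p.1 p.2 := rfl

lemma norm_vectorize_sq (A : Matrix (Fin k) (Fin k) ℂ) :
    ‖vectorize k A‖ ^ 2 = (star A * A).trace.re := by
  rw [EuclideanSpace.norm_sq_eq, Matrix.trace, Fintype.sum_prod_type_right]
  simp only [Matrix.diag_apply, Matrix.mul_apply, Matrix.star_apply, Complex.re_sum,
    vectorize_apply]
  refine Finset.sum_congr rfl fun j _ => Finset.sum_congr rfl fun i _ => ?_
  rw [Complex.star_def, ← Complex.normSq_eq_conj_mul_self, Complex.ofReal_re,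
    Complex.normSq_eq_norm_sq]

lemma norm_vectorize (hk : 0 < k) (A : Matrix (Fin k) (Fin k) ℂ) :
    ‖vectorize k A‖ = √k * traceNorm (normTraceLinear k) A := by
  have hk' : (0 : ℝ) < k := by exact_mod_cast hk
  rw [← Real.sqrt_sq (norm_nonneg (vectorize k A)), traceNorm, ← Real.sqrt_mul hk'.le,
    norm_vectorize_sq]
  congr 1
  rw [normTraceLinear_apply, normTrace, Complex.div_natCast_re]
  field_simp

/-- The operator `U ↦ (1/N) ∑ₗ Vₗ U Wₗ⋆` on matrices. -/
def averaging {N : ℕ} (V W : Fin N → Matrix (Fin k) (Fin k) ℂ) :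
    Matrix (Fin k) (Fin k) ℂ →ₗ[ℂ] Matrix (Fin k) (Fin k) ℂ :=
  (N : ℂ)⁻¹ • ∑ l, LinearMap.mulLeftRight ℂ (V l, star (W l))

lemma averaging_apply {N : ℕ} (V W : Fin N → Matrix (Fin k) (Fin k) ℂ)
    (U : Matrix (Fin k) (Fin k) ℂ) :
    averaging V W U = (N : ℂ)⁻¹ • ∑ l, V l * U * star (W l) := by
  simp [averaging]

/-- Summation over the matrix units `E` of `Tr(X⋆ E⋆ Y E X')`. -/
lemma sum_trace_single (Y X X' : Matrix (Fin k) (Fin k) ℂ) :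
    ∑ p : Fin k × Fin k, (star X * star (Matrix.single p.1 p.2 (1 : ℂ)) * Y *
      Matrix.single p.1 p.2 1 * X').trace = Y.trace * (X' * star X).trace := by
  have h : ∀ p : Fin k × Fin k, (star X * star (Matrix.single p.1 p.2 (1 : ℂ)) * Y *
      Matrix.single p.1 p.2 1 * X').trace = Y p.1 p.1 * (X' * star X) p.2 p.2 := by
    intro p
    have e : star (Matrix.single p.1 p.2 (1 : ℂ)) * Y * Matrix.single p.1 p.2 1
        = Matrix.single p.2 p.2 (Y p.1 p.1) := by
      rw [Matrix.star_eq_conjTranspose, Matrix.conjTranspose_single, star_one,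
        Matrix.single_mul_mul_single, one_mul, mul_one]
    rw [mul_assoc (star X), mul_assoc (star X), e, mul_assoc, Matrix.trace_mul_comm, mul_assoc,
      Matrix.trace_single_mul, smul_eq_mul]
  simp only [h]
  rw [Fintype.sum_prod_type, Matrix.trace, Matrix.trace, Finset.sum_mul_sum]
  rfl

/-- The Hilbert–Schmidt norm of the averaging operator, in terms of traces. -/
lemma sum_norm_averaging_sq {N : ℕ} (V W : Fin N → Matrix (Fin k) (Fin k) ℂ) :
    ∑ p : Fin k × Fin k, ‖vectorize k (averaging V W (Matrix.single p.1 p.2 1))‖ ^ 2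
      = ((N : ℝ) ^ 2)⁻¹ *
        (∑ l, ∑ l', (star (V l) * V l').trace * (star (W l') * W l).trace).re := by
  have h : ∀ p : Fin k × Fin k,
      ‖vectorize k (averaging V W (Matrix.single p.1 p.2 1))‖ ^ 2 = ((N : ℝ) ^ 2)⁻¹ *
        (∑ l, ∑ l', (star (star (W l)) * star (Matrix.single p.1 p.2 (1 : ℂ)) *
          (star (V l) * V l') * Matrix.single p.1 p.2 1 * star (W l')).trace).re := by
    intro p
    rw [norm_vectorize_sq, averaging_apply, star_smul, smul_mul_smul_comm, star_sum,
      Finset.sum_mul_sum, Matrix.trace_smul, smul_eq_mul]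
    have e : star ((N : ℂ)⁻¹) * (N : ℂ)⁻¹ = (((N : ℝ) ^ 2)⁻¹ : ℝ) := by
      simp [sq]
    rw [e, Complex.re_ofReal_mul, Matrix.trace_sum]
    simp only [Matrix.trace_sum, star_mul, mul_assoc]
  simp only [h]
  rw [← Finset.mul_sum, ← Complex.re_sum]
  congr 2
  rw [Finset.sum_comm]
  refine Finset.sum_congr rfl fun l _ => ?_
  rw [Finset.sum_comm]
  refine Finset.sum_congr rfl fun l' _ => ?_
  rw [sum_trace_single, star_star]

/-- If the families `V` and `W` are nearly orthonormal for the normalized trace, like the powers of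
a Haar unitary, then the averaging operator has squared Hilbert–Schmidt norm at most `2 k² / N`. -/
lemma sum_norm_averaging_sq_le {N : ℕ} (hN : 0 < N) (hk : 0 < k)
    (V W : Fin N → Matrix (Fin k) (Fin k) ℂ) {η : ℝ} (hη : 3 * N * η ≤ 1)
    (hV : ∀ l l', ‖normTraceLinear k (star (V l) * V l') - if l = l' then 1 else 0‖ ≤ η)
    (hW : ∀ l l', ‖normTraceLinear k (star (W l) * W l') - if l = l' then 1 else 0‖ ≤ η) :
    ∑ p : Fin k × Fin k, ‖vectorize k (averaging V W (Matrix.single p.1 p.2 1))‖ ^ 2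
      ≤ 2 * k ^ 2 / N := by
  have hN' : (1 : ℝ) ≤ N := by exact_mod_cast hN
  have hk' : (0 : ℝ) < k := by exact_mod_cast hk
  have hη0 : 0 ≤ η := (norm_nonneg _).trans (hV ⟨0, hN⟩ ⟨0, hN⟩)
  have hη1 : η ≤ 1 := by nlinarith
  have htr : ∀ A : Matrix (Fin k) (Fin k) ℂ, A.trace = k * normTraceLinear k A := by
    intro A
    have : (k : ℂ) ≠ 0 := by exact_mod_cast hk.ne'
    rw [normTraceLinear_apply, normTrace]
    field_simp
  have hterm : ∀ l l', ((star (V l) * V l').trace * (star (W l') * W l).trace).re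
      ≤ k ^ 2 * ((if l = l' then 1 else 0) + 3 * η) := by
    intro l l'
    set a := normTraceLinear k (star (V l) * V l') with ha
    set c := normTraceLinear k (star (W l') * W l) with hc
    set d : ℂ := if l = l' then 1 else 0 with hd
    have h1 : ‖a - d‖ ≤ η := hV l l'
    have h2 : ‖c - d‖ ≤ η := by simpa only [hd, eq_comm] using hW l' l
    have hd1 : ‖d‖ ≤ 1 := by rw [hd]; split_ifs <;> simp
    have e : a * c = d * d + ((a - d) * d + d * (c - d) + (a - d) * (c - d)) := by ring
    have h3 : ‖(a - d) * d + d * (c - d) + (a - d) * (c - d)‖ ≤ 3 * η := by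
      refine (norm_add₃_le).trans ?_
      rw [norm_mul, norm_mul, norm_mul]
      have i1 : ‖a - d‖ * ‖d‖ ≤ η * 1 := by gcongr
      have i2 : ‖d‖ * ‖c - d‖ ≤ 1 * η := by gcongr
      have i3 : ‖a - d‖ * ‖c - d‖ ≤ 1 * η := by gcongr; exact h1.trans hη1
      linarith
    have h4 : (d * d).re = if l = l' then 1 else 0 := by rw [hd]; split_ifs <;> simp
    have h5 : (a * c).re ≤ (if l = l' then 1 else 0) + 3 * η := by
      rw [e, Complex.add_re, h4]
      exact add_le_add_right ((Complex.re_le_norm _).trans h3) _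
    have h6 : ((star (V l) * V l').trace * (star (W l') * W l).trace).re = k ^ 2 * (a * c).re := by
      rw [htr, htr (star (W l') * W l), ← ha, ← hc,
        show (k : ℂ) * a * (k * c) = ((k ^ 2 : ℝ) : ℂ) * (a * c) by push_cast; ring,
        Complex.re_ofReal_mul]
    rw [h6]
    gcongr
  rw [sum_norm_averaging_sq, Complex.re_sum]
  have hsum : ∑ l : Fin N, (∑ l' : Fin N,
      (star (V l) * V l').trace * (star (W l') * W l).trace).re ≤ k ^ 2 * (2 * N) := by
    calc _ ≤ ∑ l : Fin N, ∑ l' : Fin N, (k : ℝ) ^ 2 * ((if l = l' then 1 else 0) + 3 * η) := by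
          refine Finset.sum_le_sum fun l _ => ?_
          rw [Complex.re_sum]
          exact Finset.sum_le_sum fun l' _ => hterm l l'
      _ = k ^ 2 * (N + N * (3 * N * η)) := by
          simp only [← Finset.mul_sum, Finset.sum_add_distrib, Finset.sum_ite_eq, Finset.mem_univ,
            if_true, Finset.sum_const, Finset.card_univ, Fintype.card_fin, nsmul_eq_mul, mul_one]
          ring
      _ ≤ k ^ 2 * (2 * N) := by
          gcongr
          nlinarith
  calc _ ≤ ((N : ℝ) ^ 2)⁻¹ * (k ^ 2 * (2 * N)) := by gcongr
    _ = 2 * k ^ 2 / N := by field_simp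

/-- The matrices that are almost fixed by the averaging operator of two nearly orthonormal families
are covered by few balls for the 2-norm. -/
lemma exists_net_averaging {N : ℕ} (hN : 0 < N) (hk : 0 < k)
    (V W : Fin N → Matrix (Fin k) (Fin k) ℂ) {η S ρ : ℝ} (hη : 3 * N * η ≤ 1)
    (hV : ∀ l l', ‖normTraceLinear k (star (V l) * V l') - if l = l' then 1 else 0‖ ≤ η)
    (hW : ∀ l l', ‖normTraceLinear k (star (W l) * W l') - if l = l' then 1 else 0‖ ≤ η)
    (hS : 0 < S) (hρ : 0 < ρ) :
    ∃ s : Finset (Matrix (Fin k) (Fin k) ℂ),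
      (s.card : ℝ) ≤ (5 + 2 * S / ρ) ^ (4 * S ^ 2 / ρ ^ 2 / N * k ^ 2) ∧
      ∀ U, traceNorm (normTraceLinear k) U ≤ S →
        traceNorm (normTraceLinear k) (averaging V W U - U) ≤ ρ →
        ∃ c ∈ s, traceNorm (normTraceLinear k) (U - c) ≤ 3 * ρ := by
  classical
  have hk' : (0 : ℝ) < √k := Real.sqrt_pos.2 (by exact_mod_cast hk)
  let T : EuclideanSpace ℂ (Fin k × Fin k) →ₗ[ℂ] EuclideanSpace ℂ (Fin k × Fin k) :=
    (vectorize k).toLinearMap ∘ₗ averaging V W ∘ₗ (vectorize k).symm.toLinearMap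
  have hTv : ∀ U, T (vectorize k U) = vectorize k (averaging V W U) := fun U => by simp [T]
  have hT : ∑ p, ‖T (EuclideanSpace.basisFun (Fin k × Fin k) ℂ p)‖ ^ 2 ≤ 2 * k ^ 2 / N := by
    refine le_trans (le_of_eq ?_) (sum_norm_averaging_sq_le hN hk V W hη hV hW)
    refine Finset.sum_congr rfl fun p _ => ?_
    rw [← hTv]
    congr 3
    ext q
    rw [vectorize_apply, Matrix.single_apply, EuclideanSpace.basisFun_apply]
    simp [Prod.ext_iff, eq_comm]
  obtain ⟨s, hs1, hs2⟩ := exists_net_approx_fixed _ T hT (mul_pos hk' hS) (mul_pos hk' hρ)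
  refine ⟨s.image (vectorize k).symm, ?_, fun U hU hTU => ?_⟩
  · rw [Finset.card_image_of_injective _ (vectorize k).symm.injective]
    refine hs1.trans (le_of_eq ?_)
    congr 1
    · field_simp
    · field_simp
      ring
  · obtain ⟨c, hc, hUc⟩ := hs2 (vectorize k U)
      (by rw [norm_vectorize hk]; gcongr)
      (by rw [hTv, ← map_sub, norm_vectorize hk]; gcongr)
    refine ⟨(vectorize k).symm c, Finset.mem_image_of_mem _ hc, ?_⟩
    obtain ⟨C, rfl⟩ := (vectorize k).surjective c
    rw [LinearEquiv.symm_apply_apply]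
    rw [← map_sub, norm_vectorize hk, mul_left_comm] at hUc
    exact le_of_mul_le_mul_left hUc hk'

end Averaging

/-! ### Orbit covering numbers and their logarithms -/

section Covering

/-- If elements of `Γ` with the same label lie in each other's orbit-balls, then `Γ` is covered by
as many orbit-balls as there are labels, centred at one representative for each label in use. -/
lemma orbitCoveringNumber_le_card {n k : ℕ} {Γ : Set (MatTuple n k)} {ω : ℝ} {ι : Type*}
    (label : MatTuple n k → ι) (J : Finset ι) (hJ : ∀ B ∈ Γ, label B ∈ J)
    (h : ∀ A ∈ Γ, ∀ B ∈ Γ, label A = label B → A ∈ orbitBall B ω) :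
    orbitCoveringNumber Γ ω ≤ J.card := by
  classical
  have hrep : ∀ i ∈ label '' Γ, ∃ B ∈ Γ, label B = i := fun i hi => hi
  choose! rep hrepΓ hrepi using hrep
  refine (iInf₂_le (rep '' (label '' Γ)) ?_).trans ((iInf_le _ ?_).trans ?_)
  · rintro _ ⟨i, hi, rfl⟩
    exact hrepΓ i hi
  · intro A hA
    have hi : label A ∈ label '' Γ := ⟨A, hA, rfl⟩
    refine Set.mem_iUnion₂.2 ⟨rep (label A), ⟨_, hi, rfl⟩, ?_⟩
    exact h A hA _ (hrepΓ _ hi) (hrepi _ hi).symm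
  · refine (Set.encard_image_le _ _).trans ?_
    rw [← Set.encard_coe_eq_coe_finsetCard]
    refine Set.encard_le_encard ?_
    rintro _ ⟨B, hB, rfl⟩
    exact hJ B hB

/-- Labels with two parts: the first is one of finitely many values, and within each value the
second is a net of at most `M` points for an auxiliary matrix `U B`. -/
lemma exists_orbitCoveringNumber_le_mul {n k : ℕ} (hk : 0 < k) {Γ : Set (MatTuple n k)} {ω ρ M : ℝ}
    {ι : Type*} (F : Finset ι) (lab : MatTuple n k → ι) (hF : ∀ B ∈ Γ, lab B ∈ F)
    (U : MatTuple n k → Matrix (Fin k) (Fin k) ℂ)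
    (hnet : ∀ i ∈ F, ∃ s : Finset (Matrix (Fin k) (Fin k) ℂ), (s.card : ℝ) ≤ M ∧
      ∀ B ∈ Γ, lab B = i → ∃ c ∈ s, traceNorm (normTraceLinear k) (U B - c) ≤ ρ)
    (hclose : ∀ A ∈ Γ, ∀ B ∈ Γ, lab A = lab B →
      traceNorm (normTraceLinear k) (U A - U B) ≤ 2 * ρ → A ∈ orbitBall B ω) :
    ∃ J : ℕ, orbitCoveringNumber Γ ω ≤ J ∧ (J : ℝ) ≤ F.card * M := by
  classical
  have hτ := isTracialState_normTraceLinear hk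
  choose! s hs1 hs2 using hnet
  have hc : ∀ B ∈ Γ, ∃ c ∈ s (lab B), traceNorm (normTraceLinear k) (U B - c) ≤ ρ :=
    fun B hB => hs2 _ (hF B hB) B hB rfl
  choose! c hc1 hc2 using hc
  refine ⟨(F.sigma s).card, orbitCoveringNumber_le_card
    (fun B => (⟨lab B, c B⟩ : Σ _ : ι, Matrix (Fin k) (Fin k) ℂ)) _
    (fun B hB => Finset.mem_sigma.2 ⟨hF B hB, hc1 B hB⟩) fun A hA B hB hAB => ?_, ?_⟩
  · obtain ⟨h1, h2⟩ := Sigma.mk.inj hAB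
    refine hclose A hA B hB h1 ?_
    have h3 := hc2 B hB
    rw [← eq_of_heq h2, traceNorm_sub_comm] at h3
    have := hτ.traceNorm_sub_le (U A) (c A) (U B)
    have := hc2 A hA
    linarith
  · rw [Finset.card_sigma]
    push_cast
    calc _ ≤ ∑ i ∈ F, M := Finset.sum_le_sum hs1
      _ = _ := by simp

/-- A numerical bound for the covering number bounds its logarithm; `r ≥ 0` accounts for the
convention that `logCount 0 = 0`. -/
lemma logCount_le {ν : ℕ∞} {J : ℕ} {r : ℝ} (hν : ν ≤ J) (hr : 0 ≤ r) (hJ : (J : ℝ) ≤ Real.exp r) :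
    logCount ν ≤ (r : EReal) := by
  refine max_le (by exact_mod_cast hr) ?_
  have h1 : ((ν : ℕ∞) : ℝ≥0∞) ≤ ENNReal.ofReal (Real.exp r) := by
    calc ((ν : ℕ∞) : ℝ≥0∞) ≤ ((J : ℕ∞) : ℝ≥0∞) := by exact_mod_cast hν
      _ = ENNReal.ofReal J := by simp
      _ ≤ _ := ENNReal.ofReal_le_ofReal hJ
  refine (ENNReal.log_le_log h1).trans (le_of_eq ?_)
  rw [ENNReal.log_ofReal_of_pos (Real.exp_pos r), Real.log_exp]

/-- A bound for the logarithmic covering number provides a cover. -/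
lemma exists_cover_of_logCount_le {n k : ℕ} {Γ : Set (MatTuple n k)} {ω r : ℝ}
    (h : logCount (orbitCoveringNumber Γ ω) ≤ (r : EReal)) :
    ∃ F : Finset (MatTuple n k), (F.card : ℝ) ≤ Real.exp r ∧
      ∀ A ∈ Γ, ∃ B ∈ F, A ∈ orbitBall B ω := by
  have h1 : ((orbitCoveringNumber Γ ω : ℕ∞) : ℝ≥0∞) ≤ ENNReal.ofReal (Real.exp r) := by
    have h2 := (le_max_right _ _).trans h
    rwa [← Real.log_exp r, ← ENNReal.log_ofReal_of_pos (Real.exp_pos r),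
      ENNReal.log_le_log_iff] at h2
  have hne : orbitCoveringNumber Γ ω ≠ ⊤ := by
    intro h0
    rw [h0] at h1
    simp at h1
  obtain ⟨J, hJ⟩ := ENat.ne_top_iff_exists.1 hne
  have h3 : orbitCoveringNumber Γ ω < (J + 1 : ℕ) := by
    rw [← hJ]
    exact_mod_cast Nat.lt_succ_self J
  simp only [orbitCoveringNumber, iInf_lt_iff] at h3
  obtain ⟨F, -, hcov, hcard⟩ := h3
  have hfin : F.Finite := Set.finite_of_encard_le_coe hcard.le
  refine ⟨hfin.toFinset, ?_, fun A hA => ?_⟩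
  · have h4 : hfin.toFinset.card ≤ J := by
      rw [hfin.encard_eq_coe_toFinset_card] at hcard
      exact Nat.lt_succ_iff.1 (by exact_mod_cast hcard)
    have h5 : (J : ℝ) ≤ Real.exp r := by
      rw [← hJ] at h1
      have h6 : ENNReal.ofReal (J : ℝ) ≤ ENNReal.ofReal (Real.exp r) := by simpa using h1
      exact (ENNReal.ofReal_le_ofReal_iff (Real.exp_pos r).le).1 h6
    exact le_trans (by exact_mod_cast h4) h5
  · obtain ⟨B, hB, hAB⟩ := Set.mem_iUnion₂.1 (hcov hA)
    exact ⟨B, by simpa using hB, hAB⟩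

end Covering

section Asymptotics

variable {A : Type*} [Monoid A] [Star A] {τ : A → ℂ} {n : ℕ} {x : Fin n → A}

lemma denominator_pos {ω : ℝ} (h0 : 0 < ω) (h1 : ω < 1) {k : ℕ} (hk : 0 < k) :
    0 < -(k : ℝ) ^ 2 * Real.log ω := by
  have : (0 : ℝ) < k := by exact_mod_cast hk
  nlinarith [mul_pos (pow_pos this 2) (neg_pos.2 (Real.log_neg h0 h1))]

/-- What `𝔎₂(x) ≤ 0` means: for `ω < 1` and every `r > 0`, the microstates of `x` of a suitable
order and precision have orbit covers of size at most `exp(r k²)`. -/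
lemma exists_cover_of_upperOrbitDimTuple_le (hx : upperOrbitDimTuple τ x ≤ 0) {ω R r : ℝ}
    (h0 : 0 < ω) (h1 : ω < 1) (hR : 0 < R) (hr : 0 < r) :
    ∃ m : ℕ, ∃ ε : ℝ, 0 < ε ∧ ∀ᶠ k : ℕ in atTop, ∃ F : Finset (MatTuple n k),
      (F.card : ℝ) ≤ Real.exp (r * k ^ 2) ∧
      ∀ B ∈ microstates τ x R m k ε, ∃ C ∈ F, B ∈ orbitBall C ω := by
  have hlog : 0 < -Real.log ω := neg_pos.2 (Real.log_neg h0 h1)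
  have h2 : orbitDimAtRadius τ x ω R ≤ 0 := by
    refine le_trans ?_ hx
    refine le_trans ?_ (le_iSup₂_of_le ω h0 (le_iSup (fun _ => orbitDimAt τ x ω) h1))
    exact le_iSup₂ (f := fun R (_ : 0 < R) => orbitDimAtRadius τ x ω R) R hR
  have h3 : orbitDimAtRadius τ x ω R < ((r / -Real.log ω : ℝ) : EReal) :=
    h2.trans_lt (by exact_mod_cast div_pos hr hlog)
  simp only [orbitDimAtRadius, iInf_lt_iff] at h3
  obtain ⟨m, ε, hε, hlim⟩ := h3
  refine ⟨m, ε, hε, ?_⟩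
  filter_upwards [eventually_lt_of_limsup_lt hlim, eventually_gt_atTop 0] with k hk hk0
  apply exists_cover_of_logCount_le
  have hd := denominator_pos h0 h1 hk0
  rw [EReal.div_lt_iff (by exact_mod_cast hd) (EReal.coe_ne_top _)] at hk
  refine hk.le.trans (le_of_eq ?_)
  rw [← EReal.coe_mul]
  congr 1
  have hne : Real.log ω ≠ 0 := (Real.log_neg h0 h1).ne
  field_simp

/-- A criterion for `𝔎₂(x) ≤ 0`. -/
lemma upperOrbitDimTuple_le_zero
    (h : ∀ ω R r : ℝ, 0 < ω → ω < 1 → 0 < R → 0 < r → ∃ m : ℕ, ∃ ε : ℝ, 0 < ε ∧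
      ∀ᶠ k : ℕ in atTop, ∃ J : ℕ, orbitCoveringNumber (microstates τ x R m k ε) ω ≤ J ∧
        (J : ℝ) ≤ Real.exp (r * k ^ 2)) :
    upperOrbitDimTuple τ x ≤ 0 := by
  refine iSup_le fun ω => iSup_le fun h0 => iSup_le fun h1 => iSup_le fun R => iSup_le fun hR => ?_
  have hlog : 0 < -Real.log ω := neg_pos.2 (Real.log_neg h0 h1)
  by_contra! hlt
  obtain ⟨δ, hδ0, hδ⟩ := EReal.lt_iff_exists_real_btwn.1 hlt
  have hδ0' : 0 < δ := by exact_mod_cast hδ0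
  obtain ⟨m, ε, hε, hev⟩ := h ω R (δ * -Real.log ω) h0 h1 hR (mul_pos hδ0' hlog)
  refine absurd hδ (not_lt.2 ?_)
  refine (iInf₂_le m ε).trans ((iInf_le _ hε).trans ?_)
  refine limsup_le_of_le (by isBoundedDefault) ?_
  filter_upwards [hev, eventually_gt_atTop 0] with k hk hk0
  obtain ⟨J, hJ1, hJ2⟩ := hk
  have hd := denominator_pos h0 h1 hk0
  rw [EReal.div_le_iff_le_mul (by exact_mod_cast hd) (EReal.coe_ne_top _)]
  refine (logCount_le hJ1 (by positivity) hJ2).trans (le_of_eq ?_)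
  rw [← EReal.coe_mul]
  congr 1
  ring

lemma upperOrbitDimTuple_nonneg (τ : A → ℂ) (x : Fin n → A) : 0 ≤ upperOrbitDimTuple τ x := by
  refine le_iSup_of_le (1 / 2) (le_iSup_of_le (by norm_num) (le_iSup_of_le (by norm_num)
    (le_iSup_of_le 1 (le_iSup_of_le one_pos ?_))))
  refine le_iInf fun m => le_iInf fun ε => le_iInf fun hε => ?_
  refine le_limsup_of_frequently_le (Frequently.of_forall fun k => ?_) (by isBoundedDefault)
  refine EReal.div_nonneg (le_max_left _ _) ?_
  have : Real.log (1 / 2) ≤ 0 := Real.log_nonpos (by norm_num) (by norm_num)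
  have h2 : 0 ≤ -(k : ℝ) ^ 2 * Real.log (1 / 2) := by nlinarith [sq_nonneg (k : ℝ)]
  exact_mod_cast h2

end Asymptotics

/-! ### Counting orbits of microstates of a tuple with an approximate intertwiner -/

/-- The `⋆`-polynomial `(1/N) ∑ₗ Vₗ(x) u Wₗ(x)⋆` in the variables `u, x₁, …, xₙ`. -/
def NCPoly.averaging {N n : ℕ} (V W : Fin N → NCPoly n) : NCPoly (n + 1) :=
  .mul (.const (N : ℂ)⁻¹) (.sum (List.ofFn fun l =>
    .mul (.mul ((V l).subst fun i => .var i.succ) (.var 0)) (.adj ((W l).subst fun i => .var i.succ))))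

lemma NCPoly.eval_averaging {A : Type*} [Ring A] [StarRing A] [Algebra ℂ A] {N n : ℕ}
    (V W : Fin N → NCPoly n) (z : Fin (n + 1) → A) :
    (NCPoly.averaging V W).eval z = (N : ℂ)⁻¹ • ∑ l, (V l).eval (fun i => z i.succ) * z 0 *
      star ((W l).eval fun i => z i.succ) := by
  simp [NCPoly.averaging, List.map_ofFn, List.sum_ofFn, Algebra.smul_def]

/-- The covering estimate in one matrix size. Microstates `B` are labelled by the orbit-ball that
contains the part `X(B)` of `Z(B) = (U(B), X(B))`, and by a point of a net that is close to the
correspondingly rotated matrix `U(B)`. The net is small because `U(B)` is almost fixed by an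
averaging operator of small Hilbert–Schmidt norm, and the label determines `B` up to a rotation and
a small error because `Y(Z(B))` is close to `B`. -/
lemma exists_orbitCoveringNumber_le {n p N k : ℕ} (hk : 0 < k) (hN : 0 < N)
    (V W : Fin N → NCPoly n) (Y : Fin p → NCPoly (n + 1)) (Z : Fin (n + 1) → NCPoly p)
    {S ρ ω ω' η : ℝ} {Γ : Set (MatTuple p k)} (hη : 3 * N * η ≤ 1) (hS : 0 < S) (hρ : 0 < ρ)
    (hω : 0 < ω) (hω' : 0 < ω')
    (hZ : ∀ B ∈ Γ, ∀ i, ‖(Z i).eval B‖ ≤ S)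
    (hV : ∀ B ∈ Γ, ∀ l l', ‖normTraceLinear k (star ((V l).eval fun i => (Z i.succ).eval B) *
      (V l').eval fun i => (Z i.succ).eval B) - if l = l' then 1 else 0‖ ≤ η)
    (hW : ∀ B ∈ Γ, ∀ l l', ‖normTraceLinear k (star ((W l).eval fun i => (Z i.succ).eval B) *
      (W l').eval fun i => (Z i.succ).eval B) - if l = l' then 1 else 0‖ ≤ η)
    (hT : ∀ B ∈ Γ, traceNorm (normTraceLinear k)
      ((NCPoly.averaging V W).eval (fun i => (Z i).eval B) - (Z 0).eval B) ≤ ρ / 2)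
    (hY : ∀ B ∈ Γ, ∀ j, traceNorm (normTraceLinear k)
      ((Y j).eval (fun i => (Z i).eval B) - B j) ≤ ω / (8 * (p + 1)))
    (hlipT : (NCPoly.averaging V W).lip S * (2 * ω') ≤ ρ / 2) (hωρ : 2 * ω' ≤ 6 * ρ)
    (hlipY : ∀ j, (Y j).lip S * (6 * ρ) ≤ ω / (8 * (p + 1)))
    (F : Finset (MatTuple n k))
    (hF : ∀ B ∈ Γ, ∃ C ∈ F, (fun i => (Z i.succ).eval B) ∈ orbitBall C ω') :
    ∃ J : ℕ, orbitCoveringNumber Γ ω ≤ J ∧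
      (J : ℝ) ≤ F.card * (5 + 2 * S / ρ) ^ (4 * S ^ 2 / ρ ^ 2 / N * (k : ℝ) ^ 2) := by
  classical
  have hτ := isTracialState_normTraceLinear hk
  have hF' : ∀ B ∈ Γ, ∃ C ∈ F, ∃ w ∈ unitary (Matrix (Fin k) (Fin k) ℂ),
      tupleNorm2 (fun j => (Z j.succ).eval B - w * C j * star w) < ω' := hF
  choose! lab hlab w hw hdist using hF'
  -- The rotated tuple `Z(B)`, whose `X`-part is close to the centre of its orbit-ball.
  let z : MatTuple p k → Fin (n + 1) → Matrix (Fin k) (Fin k) ℂ :=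
    fun B i => star (w B) * (Z i).eval B * w B
  have hz : ∀ B ∈ Γ, ∀ P : NCPoly (n + 1),
      P.eval (z B) = star (w B) * P.eval (fun i => (Z i).eval B) * w B :=
    fun B hB P => P.eval_unitary_conj (hw B hB) _
  have hz' : ∀ B ∈ Γ, ∀ P : NCPoly n, (P.eval fun i => z B i.succ)
      = star (w B) * P.eval (fun i => (Z i.succ).eval B) * w B :=
    fun B hB P => P.eval_unitary_conj (hw B hB) _
  have hconj : ∀ B ∈ Γ, ∀ a, traceNorm (normTraceLinear k) (star (w B) * a * w B)
      = traceNorm (normTraceLinear k) a := by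
    intro B hB a
    rw [hτ.traceNorm_mul_unitary (hw B hB), traceNorm_unitary_mul _ (Unitary.star_mem (hw B hB))]
  have hzS : ∀ B ∈ Γ, ∀ i, ‖z B i‖ ≤ S := by
    intro B hB i
    rw [CStarRing.norm_mul_mem_unitary _ (hw B hB),
      CStarRing.norm_mem_unitary_mul _ (Unitary.star_mem (hw B hB))]
    exact hZ B hB i
  have hzlab : ∀ B ∈ Γ, ∀ i, traceNorm (normTraceLinear k) (z B i.succ - lab B i) ≤ ω' := by
    intro B hB i
    have h1 := (traceNorm_le_tupleNorm2 hk _ i).trans (hdist B hB).le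
    rw [← hconj B hB] at h1
    refine le_trans (le_of_eq ?_) h1
    congr 1
    have e : star (w B) * w B = 1 := Unitary.star_mul_self_of_mem (hw B hB)
    simp only [z, mul_sub, sub_mul, mul_assoc]
    rw [e, mul_one, ← mul_assoc (star (w B)) (w B) (lab B i), e, one_mul]
  have hzz : ∀ A ∈ Γ, ∀ B ∈ Γ, lab A = lab B → ∀ i : Fin n,
      traceNorm (normTraceLinear k) (z A i.succ - z B i.succ) ≤ 2 * ω' := by
    intro A hA B hB hAB i
    have h1 := hzlab A hA i
    have h2 := hzlab B hB i
    rw [← hAB, traceNorm_sub_comm] at h2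
    have := hτ.traceNorm_sub_le (z A i.succ) (lab A i) (z B i.succ)
    linarith
  have htr : ∀ B ∈ Γ, ∀ a b, normTraceLinear k (star (star (w B) * a * w B) *
      (star (w B) * b * w B)) = normTraceLinear k (star a * b) := by
    intro B hB a b
    have e : w B * star (w B) = 1 := Unitary.mul_star_self_of_mem (hw B hB)
    have e2 : star (star (w B) * a * w B) * (star (w B) * b * w B)
        = star (w B) * (star a * b * w B) := by
      simp only [star_mul, star_star, mul_assoc]
      rw [← mul_assoc (w B) (star (w B)), e, one_mul]
    rw [e2, hτ.tracial, mul_assoc, e, mul_one]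
  have hM : 0 ≤ (5 + 2 * S / ρ) ^ (4 * S ^ 2 / ρ ^ 2 / N * (k : ℝ) ^ 2) := by positivity
  refine exists_orbitCoveringNumber_le_mul (ρ := 3 * ρ) hk F lab hlab (fun B => z B 0) ?_ ?_
  · intro C _
    by_cases hC : ∃ B₀ ∈ Γ, lab B₀ = C
    · obtain ⟨B₀, hB₀, rfl⟩ := hC
      obtain ⟨s, hs1, hs2⟩ := exists_net_averaging hN hk
        (fun l => (V l).eval fun i => z B₀ i.succ) (fun l => (W l).eval fun i => z B₀ i.succ) hη
        (fun l l' => by rw [hz' B₀ hB₀, hz' B₀ hB₀, htr B₀ hB₀]; exact hV B₀ hB₀ l l')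
        (fun l l' => by rw [hz' B₀ hB₀, hz' B₀ hB₀, htr B₀ hB₀]; exact hW B₀ hB₀ l l') hS hρ
      refine ⟨s, hs1, fun B hB hBB => hs2 _ ?_ ?_⟩
      · exact (hτ.traceNorm_le_norm _).trans (hzS B hB 0)
      · -- The averaging operators at `X(B₀)` and `X(B)` are close by the Lipschitz bound.
        let z₀ : Fin (n + 1) → Matrix (Fin k) (Fin k) ℂ :=
          Fin.cons (z B 0) fun i => z B₀ i.succ
        have e : averaging (fun l => (V l).eval fun i => z B₀ i.succ)
            (fun l => (W l).eval fun i => z B₀ i.succ) (z B 0)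
            = (NCPoly.averaging V W).eval z₀ := by
          rw [averaging_apply, NCPoly.eval_averaging]
          simp [z₀]
        have h1 : traceNorm (normTraceLinear k)
            ((NCPoly.averaging V W).eval z₀ - (NCPoly.averaging V W).eval (z B)) ≤ ρ / 2 := by
          refine (NCPoly.traceNorm_eval_sub_le hτ (R := S) (d := 2 * ω') ?_ (hzS B hB)
            (by positivity) ?_ _).trans hlipT
          · intro i
            refine Fin.cases ?_ (fun i => ?_) i
            · exact hzS B hB 0
            · exact hzS B₀ hB₀ i.succ
          · intro i
            refine Fin.cases ?_ (fun i => ?_) i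
            · simp [z₀, traceNorm_zero, hω'.le]
            · exact hzz B₀ hB₀ B hB hBB.symm i
        have h2 : traceNorm (normTraceLinear k) ((NCPoly.averaging V W).eval (z B) - z B 0)
            ≤ ρ / 2 := by
          rw [hz B hB, show z B 0 = star (w B) * (Z 0).eval B * w B from rfl, ← sub_mul,
            ← mul_sub, hconj B hB]
          exact hT B hB
        rw [e]
        have := hτ.traceNorm_sub_le ((NCPoly.averaging V W).eval z₀)
          ((NCPoly.averaging V W).eval (z B)) (z B 0)
        linarith
    · refine ⟨∅, by simpa using hM, fun B hB hBC => absurd ⟨B, hB, hBC⟩ hC⟩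
  · intro A hA B hB hAB hU
    have hclose : ∀ j, traceNorm (normTraceLinear k)
        (star (w A) * A j * w A - star (w B) * B j * w B) ≤ ω / (2 * (p + 1)) := by
      intro j
      have h1 : traceNorm (normTraceLinear k) ((Y j).eval (z A) - (Y j).eval (z B))
          ≤ ω / (8 * (p + 1)) := by
        refine (NCPoly.traceNorm_eval_sub_le hτ (R := S) (d := 6 * ρ) (hzS A hA) (hzS B hB)
          (by positivity) (fun i => ?_) _).trans (hlipY j)
        refine Fin.cases ?_ (fun i => ?_) i
        · linarith
        · exact (hzz A hA B hB hAB i).trans hωρ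
      have h2 : ∀ D ∈ Γ, traceNorm (normTraceLinear k) ((Y j).eval (z D) -
          star (w D) * D j * w D) ≤ ω / (8 * (p + 1)) := by
        intro D hD
        rw [hz D hD, ← sub_mul, ← mul_sub, hconj D hD]
        exact hY D hD j
      have h3 := h2 A hA
      have h4 := h2 B hB
      rw [traceNorm_sub_comm] at h3
      have h5 := hτ.traceNorm_sub_le (star (w A) * A j * w A) ((Y j).eval (z A))
        (star (w B) * B j * w B)
      have h6 := hτ.traceNorm_sub_le ((Y j).eval (z A)) ((Y j).eval (z B))
        (star (w B) * B j * w B)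
      have h7 : 4 * (ω / (8 * ((p : ℝ) + 1))) = ω / (2 * (p + 1)) := by field_simp; ring
      have h8 : 0 ≤ ω / (8 * ((p : ℝ) + 1)) := by positivity
      linarith
    refine ⟨w A * star (w B), mul_mem (hw A hA) (Unitary.star_mem (hw B hB)), ?_⟩
    have e : ∀ j, traceNorm (normTraceLinear k)
        (A j - w A * star (w B) * B j * star (w A * star (w B))) ≤ ω / (2 * (p + 1)) := by
      intro j
      refine le_trans (le_of_eq ?_) (hclose j)
      rw [← hconj A hA]
      have e1 : star (w A) * w A = 1 := Unitary.star_mul_self_of_mem (hw A hA)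
      congr 1
      simp only [mul_sub, sub_mul, mul_assoc, star_mul, star_star]
      rw [e1, mul_one, ← mul_assoc (star (w A)) (w A), e1, one_mul]
    refine (tupleNorm2_le_sum hk _).trans_lt ?_
    calc _ ≤ ∑ _j : Fin p, ω / (2 * (p + 1)) := Finset.sum_le_sum fun j _ => e j
      _ = p * (ω / (2 * (p + 1))) := by simp
      _ < ω := by
        have : (0 : ℝ) ≤ p := Nat.cast_nonneg p
        rw [← mul_div_assoc, div_lt_iff₀ (by positivity)]
        nlinarith

/-! ### Vanishing of the upper free orbit-dimension in a tracial `C⋆`-algebra -/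

section Core

variable {A : Type*} [CStarAlgebra A] {τ : A →ₗ[ℂ] ℂ}

section Approximants

variable {n : ℕ} {S : ℝ} {z : Fin n → A} {zs : ℕ → Fin n → A}

lemma tendsto_traceNorm_eval_sub (hτ : IsTracialState τ) (hz : ∀ i, ‖z i‖ ≤ S)
    (hzs : ∀ j i, ‖zs j i‖ ≤ S) (hlim : ∀ j i, traceNorm τ (zs j i - z i) ≤ 1 / ((j : ℝ) + 1))
    (P : NCPoly n) :
    Tendsto (fun j => traceNorm τ (P.eval (zs j) - P.eval z)) atTop (𝓝 0) := by
  refine squeeze_zero (fun _ => traceNorm_nonneg _ _) (fun j =>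
    NCPoly.traceNorm_eval_sub_le hτ (hzs j) hz (by positivity) (hlim j) P) ?_
  simpa using (tendsto_one_div_add_atTop_nhds_zero_nat (𝕜 := ℝ)).const_mul (P.lip S)

lemma tendsto_map_eval (hτ : IsTracialState τ) (hz : ∀ i, ‖z i‖ ≤ S)
    (hzs : ∀ j i, ‖zs j i‖ ≤ S) (hlim : ∀ j i, traceNorm τ (zs j i - z i) ≤ 1 / ((j : ℝ) + 1))
    (P : NCPoly n) : Tendsto (fun j => τ (P.eval (zs j))) atTop (𝓝 (τ (P.eval z))) := by
  rw [tendsto_iff_norm_sub_tendsto_zero]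
  refine squeeze_zero (fun _ => norm_nonneg _) (fun j => ?_)
    (tendsto_traceNorm_eval_sub hτ hz hzs hlim P)
  rw [← map_sub]
  exact hτ.norm_map_le _

lemma eventually_traceNorm_eval_sub_lt (hτ : IsTracialState τ) (hz : ∀ i, ‖z i‖ ≤ S)
    (hzs : ∀ j i, ‖zs j i‖ ≤ S) (hlim : ∀ j i, traceNorm τ (zs j i - z i) ≤ 1 / ((j : ℝ) + 1))
    (P : NCPoly n) {a : A} {c : ℝ} (h : traceNorm τ (P.eval z - a) < c) :
    ∀ᶠ j in atTop, traceNorm τ (P.eval (zs j) - a) < c := by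
  filter_upwards [(tendsto_traceNorm_eval_sub hτ hz hzs hlim P).eventually_lt_const
    (sub_pos.2 h)] with j hj
  have := hτ.traceNorm_sub_le (P.eval (zs j)) (P.eval z) a
  linarith

end Approximants

lemma eventually_microFilter_traceNorm_lt {p : ℕ} {y : Fin p → A} {R : ℝ} (hτ : IsTracialState τ)
    (Q : NCPoly p) {c : ℝ} (h : traceNorm τ (Q.eval y) < c) :
    ∀ᶠ b in microFilter τ y R, traceNorm (normTraceLinear b.1) (Q.eval b.2) < c :=
  (tendsto_traceNorm_eval hτ.map_one Q).eventually_lt_const h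

lemma eventually_microFilter_norm_sub_lt {p : ℕ} {y : Fin p → A} {R : ℝ} (hτ : IsTracialState τ)
    (Q : NCPoly p) {d : ℂ} {c : ℝ} (h : ‖τ (Q.eval y) - d‖ < c) :
    ∀ᶠ b in microFilter τ y R, ‖normTraceLinear b.1 (Q.eval b.2) - d‖ < c :=
  ((tendsto_normTrace_eval hτ.map_one Q).sub_const d).norm.eventually_lt_const h

/-- The main estimate. Let `𝔎₂(x) ≤ 0`, let the `⋆`-polynomials in `(u, x)` and in `y` be dense in
2-norm, and suppose that `u` is almost fixed by averages `(1/N) ∑ₗ Vₗ(x) u Wₗ(x)⋆` with nearly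
orthonormal families `V(x)` and `W(x)`. Then `𝔎₂(y) ≤ 0`. -/
theorem upperOrbitDimTuple_le_zero_of_averaging (hτ : IsTracialState τ) {n p : ℕ} {x : Fin n → A}
    {u : A} {y : Fin p → A} (hx : upperOrbitDimTuple τ x ≤ 0) (hy : IsTraceDense τ y)
    (hxu : IsTraceDense τ (Fin.cons u x : Fin (n + 1) → A))
    (havg : ∀ N : ℕ, 0 < N → ∀ η : ℝ, 0 < η → ∀ κ : ℝ, 0 < κ → ∃ V W : Fin N → NCPoly n,
      (∀ l l', ‖τ (star ((V l).eval x) * (V l').eval x) - if l = l' then 1 else 0‖ < η) ∧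
      (∀ l l', ‖τ (star ((W l).eval x) * (W l').eval x) - if l = l' then 1 else 0‖ < η) ∧
      traceNorm τ ((NCPoly.averaging V W).eval (Fin.cons u x : Fin (n + 1) → A) - u) < κ) :
    upperOrbitDimTuple τ y ≤ 0 := by
  refine upperOrbitDimTuple_le_zero fun ω R r hω _ _ hr => ?_
  set z : Fin (n + 1) → A := Fin.cons u x
  have hzx : (fun i : Fin n => z i.succ) = x := by ext i; simp [z]
  -- Approximation of `y` by `⋆`-polynomials `Y` in `(u, x)`.
  have hYex : ∀ j, ∃ P : NCPoly (n + 1), traceNorm τ (P.eval z - y j) < ω / (8 * (p + 1)) :=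
    fun j => hxu (y j) _ (by positivity)
  choose Y hY using hYex
  -- A common bound `S` for `(u, x)` and all its approximants.
  choose C hC using fun i => exists_bounded_poly hτ hy (z i)
  obtain ⟨S, hS, hzS, hCS⟩ : ∃ S : ℝ, 0 < S ∧ (∀ i, ‖z i‖ ≤ S) ∧ ∀ i, C i ≤ S := by
    have h0 : ∀ i, 0 ≤ ‖z i‖ + |C i| := fun i => by positivity
    have h1 : ∀ i, ‖z i‖ + |C i| ≤ ∑ i, (‖z i‖ + |C i|) :=
      fun i => Finset.single_le_sum (fun i _ => h0 i) (Finset.mem_univ i)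
    refine ⟨1 + ∑ i, (‖z i‖ + |C i|), ?_, fun i => ?_, fun i => ?_⟩
    · have := Finset.sum_nonneg fun i (_ : i ∈ Finset.univ) => h0 i
      linarith
    · linarith [h1 i, abs_nonneg (C i)]
    · linarith [h1 i, norm_nonneg (z i), le_abs_self (C i)]
  -- The resolution `ρ` for the `u`-part is dictated by the Lipschitz constants of `Y`.
  obtain ⟨ρ, hρ, hlipY⟩ : ∃ ρ : ℝ, 0 < ρ ∧ ∀ j, (Y j).lip S * (6 * ρ) ≤ ω / (8 * (p + 1)) := by
    set L := ∑ j, (Y j).lip S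
    have hL : 0 ≤ L := Finset.sum_nonneg fun j _ => (Y j).lip_nonneg S
    refine ⟨ω / (8 * (p + 1)) / (6 * (L + 1)), by positivity, fun j => ?_⟩
    have h1 : (Y j).lip S ≤ L + 1 :=
      (Finset.single_le_sum (fun j _ => (Y j).lip_nonneg S) (Finset.mem_univ j)).trans
        (by linarith)
    calc _ ≤ (L + 1) * (6 * (ω / (8 * (p + 1)) / (6 * (L + 1)))) := by gcongr
      _ = _ := by field_simp
  -- The number `N` of averaged terms is large enough for the net exponent to be at most `r / 2`.
  set θ := Real.log (5 + 2 * S / ρ)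
  have hbase : 1 < 5 + 2 * S / ρ := by
    have : 0 < 2 * S / ρ := by positivity
    linarith
  have hθ0 : 0 < θ := Real.log_pos hbase
  obtain ⟨N, hN0, hN⟩ : ∃ N : ℕ, 0 < N ∧ θ * (4 * S ^ 2 / ρ ^ 2 / N) ≤ r / 2 := by
    obtain ⟨N, hN⟩ := exists_nat_gt (θ * (4 * S ^ 2 / ρ ^ 2) / (r / 2))
    have hN0 : (0 : ℝ) < N := lt_of_le_of_lt (by positivity) hN
    refine ⟨N, by exact_mod_cast hN0, ?_⟩
    rw [div_lt_iff₀ (by positivity)] at hN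
    rw [← mul_div_assoc, div_le_iff₀ hN0]
    linarith
  have hN0' : (0 : ℝ) < N := by exact_mod_cast hN0
  set η : ℝ := 1 / (3 * N) with hη_def
  have hη : 3 * N * η ≤ 1 := by rw [hη_def]; field_simp; exact le_rfl
  obtain ⟨V, W, hV, hW, hT⟩ := havg N hN0 η (by positivity) (ρ / 2) (by positivity)
  -- The resolution `ω'` for the `x`-part.
  set LT := (NCPoly.averaging V W).lip S
  have hLT : 0 ≤ LT := NCPoly.lip_nonneg _ _
  obtain ⟨ω', hω', hω'1, hωρ, hlipT⟩ : ∃ ω' : ℝ, 0 < ω' ∧ ω' < 1 ∧ 2 * ω' ≤ 6 * ρ ∧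
      LT * (2 * ω') ≤ ρ / 2 := by
    refine ⟨min (1 / 2) (min (3 * ρ) (ρ / (4 * (LT + 1)))), by positivity, ?_, ?_, ?_⟩
    · exact (min_le_left _ _).trans_lt (by norm_num)
    · have := (min_le_right (1 / 2) (min (3 * ρ) (ρ / (4 * (LT + 1))))).trans (min_le_left _ _)
      linarith
    · have h1 := (min_le_right (1 / 2) (min (3 * ρ) (ρ / (4 * (LT + 1))))).trans (min_le_right _ _)
      calc _ ≤ (LT + 1) * (2 * (ρ / (4 * (LT + 1)))) := by gcongr; linarith
        _ = ρ / 2 := by field_simp; ring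
  obtain ⟨m', ε', hε', hcov⟩ :=
    exists_cover_of_upperOrbitDimTuple_le hx hω' hω'1 hS (half_pos hr)
  -- Bounded approximants of `(u, x)` by `⋆`-polynomials in `y`, of increasing accuracy.
  have hZex : ∀ (j : ℕ) (i : Fin (n + 1)), ∃ P : NCPoly p,
      traceNorm τ (P.eval y - z i) < 1 / ((j : ℝ) + 1) ∧ ‖P.eval y‖ ≤ S ∧
      ∀ k, ∀ B : MatTuple p k, (∀ l, ‖B l‖ ≤ R) → ‖P.eval B‖ ≤ S := by
    intro j i
    obtain ⟨P, h1, h2, h3⟩ := hC i R (1 / ((j : ℝ) + 1)) (by positivity)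
    exact ⟨P, h1, h2.trans (hCS i), fun k B hB => (h3 k B hB).trans (hCS i)⟩
  choose Zs hZ1 hZ2 hZ3 using hZex
  have hlim : ∀ j i, traceNorm τ ((Zs j i).eval y - z i) ≤ 1 / ((j : ℝ) + 1) :=
    fun j i => (hZ1 j i).le
  have hwords : {w : List (Fin n × Bool) | w.length ≤ m'}.Finite := List.finite_length_le _ _
  have ev1 : ∀ᶠ j in atTop, ∀ w ∈ {w : List (Fin n × Bool) | w.length ≤ m'},
      ‖τ (((NCPoly.ofWord w).subst fun i => .var i.succ).eval fun i => (Zs j i).eval y) -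
        τ (wordEval x w)‖ < ε' := by
    refine (eventually_all_finite hwords).2 fun w _ => ?_
    have h1 := tendsto_map_eval hτ hzS (fun j i => hZ2 j i) hlim
      ((NCPoly.ofWord w).subst fun i => .var i.succ)
    have h2 := (h1.sub_const (τ (wordEval x w))).norm.eventually_lt_const (u := ε')
    refine h2 ?_
    simp only [NCPoly.eval_subst, NCPoly.eval_var, hzx, NCPoly.eval_ofWord, sub_self, norm_zero]
    exact hε'
  have ev2 : ∀ᶠ j in atTop, ∀ i, traceNorm τ
      ((Y i).eval (fun i => (Zs j i).eval y) - y i) < ω / (8 * (p + 1)) :=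
    eventually_all.2 fun i =>
      eventually_traceNorm_eval_sub_lt hτ hzS (fun j i => hZ2 j i) hlim (Y i) (hY i)
  have ev3 : ∀ᶠ j in atTop, traceNorm τ ((NCPoly.sub (NCPoly.averaging V W) (.var 0)).eval
      (fun i => (Zs j i).eval y)) < ρ / 2 := by
    have h := eventually_traceNorm_eval_sub_lt hτ hzS (fun j i => hZ2 j i) hlim
      (NCPoly.sub (NCPoly.averaging V W) (.var 0)) (a := 0) (c := ρ / 2)
      (by simpa [z] using hT)
    simpa using h
  have evG : ∀ G : Fin N → NCPoly n,
      (∀ l l', ‖τ (star ((G l).eval x) * (G l').eval x) - if l = l' then 1 else 0‖ < η) →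
      ∀ᶠ j in atTop, ∀ l l', ‖τ ((((NCPoly.adj (G l)).mul (G l')).subst fun i => .var i.succ).eval
        fun i => (Zs j i).eval y) - if l = l' then 1 else 0‖ < η := by
    intro G hG
    refine eventually_all.2 fun l => eventually_all.2 fun l' => ?_
    have h1 := tendsto_map_eval hτ hzS (fun j i => hZ2 j i) hlim
      (((NCPoly.adj (G l)).mul (G l')).subst fun i => .var i.succ)
    refine (h1.sub_const (if l = l' then (1 : ℂ) else 0)).norm.eventually_lt_const (u := η) ?_
    simpa only [NCPoly.eval_subst, NCPoly.eval_var, hzx, NCPoly.eval_mul, NCPoly.eval_adj]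
      using hG l l'
  obtain ⟨j, h1, h2, h3, h4, h5⟩ :=
    (ev1.and (ev2.and (ev3.and ((evG V hV).and (evG W hW))))).exists
  set Z := Zs j
  -- The same relations hold at all microstates of `y` of suitable order and precision.
  have mic1 : ∀ᶠ b in microFilter τ y R, ∀ w ∈ {w : List (Fin n × Bool) | w.length ≤ m'},
      ‖normTraceLinear b.1 ((((NCPoly.ofWord w).subst fun i => .var i.succ).subst Z).eval b.2) -
        τ (wordEval x w)‖ < ε' :=
    (eventually_all_finite hwords).2 fun w hw =>
      eventually_microFilter_norm_sub_lt hτ _ (by rw [NCPoly.eval_subst]; exact h1 w hw)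
  have mic2 : ∀ᶠ b in microFilter τ y R, ∀ i, traceNorm (normTraceLinear b.1)
      ((NCPoly.sub ((Y i).subst Z) (.var i)).eval b.2) < ω / (8 * (p + 1)) :=
    eventually_all.2 fun i => eventually_microFilter_traceNorm_lt hτ _ (by simpa using h2 i)
  have mic3 : ∀ᶠ b in microFilter τ y R, traceNorm (normTraceLinear b.1)
      (((NCPoly.sub (NCPoly.averaging V W) (.var 0)).subst Z).eval b.2) < ρ / 2 :=
    eventually_microFilter_traceNorm_lt hτ _ (by rw [NCPoly.eval_subst]; exact h3)
  have micG : ∀ G : Fin N → NCPoly n,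
      (∀ l l', ‖τ ((((NCPoly.adj (G l)).mul (G l')).subst fun i => .var i.succ).eval
        fun i => (Z i).eval y) - if l = l' then 1 else 0‖ < η) →
      ∀ᶠ b in microFilter τ y R, ∀ l l', ‖normTraceLinear b.1
        (((((NCPoly.adj (G l)).mul (G l')).subst fun i => .var i.succ).subst Z).eval b.2) -
          if l = l' then 1 else 0‖ < η :=
    fun G hG => eventually_all.2 fun l => eventually_all.2 fun l' =>
      eventually_microFilter_norm_sub_lt hτ _ (by rw [NCPoly.eval_subst]; exact hG l l')
  obtain ⟨m, ε, hε, hmic⟩ := eventually_microFilter.1 (eventually_microFilter_opNorm_le.and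
    (mic1.and (mic2.and (mic3.and ((micG V h4).and (micG W h5))))))
  refine ⟨m, ε, hε, ?_⟩
  filter_upwards [hcov, eventually_gt_atTop 0] with k hk hk0
  obtain ⟨F, hFcard, hF⟩ := hk
  have hZS : ∀ B ∈ microstates τ y R m k ε, ∀ i, ‖(Z i).eval B‖ ≤ S :=
    fun B hB i => hZ3 j i k B (hmic k hk0 B hB).1
  obtain ⟨J, hJ1, hJ2⟩ := exists_orbitCoveringNumber_le hk0 hN0 V W Y Z hη hS hρ hω hω' hZS
    (fun B hB l l' => by
      simpa using ((hmic k hk0 B hB).2.2.2.2.1 l l').le)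
    (fun B hB l l' => by
      simpa using ((hmic k hk0 B hB).2.2.2.2.2 l l').le)
    (fun B hB => by simpa using ((hmic k hk0 B hB).2.2.2.1).le)
    (fun B hB i => by simpa using ((hmic k hk0 B hB).2.2.1 i).le)
    hlipT hωρ hlipY F (fun B hB => hF _ ⟨fun i => hZS B hB i.succ, fun w _ hw => by
      have h6 := (hmic k hk0 B hB).2.1 w hw
      rw [NCPoly.eval_subst, NCPoly.eval_subst, NCPoly.eval_ofWord, normTraceLinear_apply] at h6
      exact h6⟩)
  refine ⟨J, hJ1, hJ2.trans ?_⟩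
  rw [Real.rpow_def_of_pos (by linarith)]
  have hexp : Real.exp (θ * (4 * S ^ 2 / ρ ^ 2 / N * k ^ 2)) ≤ Real.exp (r / 2 * k ^ 2) := by
    rw [← mul_assoc]
    exact Real.exp_le_exp.2 (mul_le_mul_of_nonneg_right hN (by positivity))
  calc _ ≤ Real.exp (r / 2 * k ^ 2) * Real.exp (r / 2 * k ^ 2) :=
        mul_le_mul hFcard hexp (Real.exp_pos _).le (Real.exp_pos _).le
    _ = Real.exp (r * k ^ 2) := by rw [← Real.exp_add]; congr 1; ring

end Core

/-! ### Averages of a unitary that intertwines two Haar unitaries -/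

section Haar

variable {A : Type*} [CStarAlgebra A] {τ : A →ₗ[ℂ] ℂ}

lemma map_star_pow_mul_pow (h1 : τ 1 = 1) {v : A} (hv : v ∈ unitary A)
    (hm : ∀ m : ℕ, m ≠ 0 → τ (v ^ m) = 0 ∧ τ (star v ^ m) = 0) (l l' : ℕ) :
    τ (star (v ^ l) * v ^ l') = if l = l' then 1 else 0 := by
  have h : ∀ m : ℕ, star (v ^ m) * v ^ m = 1 := fun m =>
    Unitary.star_mul_self_of_mem (pow_mem hv m)
  rcases lt_trichotomy l l' with hl | rfl | hl
  · obtain ⟨d, rfl⟩ := Nat.exists_eq_add_of_lt hl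
    rw [if_neg (by omega), add_assoc, pow_add, ← mul_assoc, h, one_mul]
    exact (hm _ (by omega)).1
  · rw [h, if_pos rfl, h1]
  · obtain ⟨d, rfl⟩ := Nat.exists_eq_add_of_lt hl
    rw [if_neg (by omega), add_assoc, pow_add, star_mul, mul_assoc, h, mul_one, star_pow]
    exact (hm _ (by omega)).2

lemma traceNorm_pow_mul_sub_le (hτ : IsTracialState τ) {u v w : A} (hv : v ∈ unitary A)
    (hw : w ∈ unitary A) (l : ℕ) :
    traceNorm τ (v ^ l * u - u * w ^ l) ≤ l * traceNorm τ (v * u - u * w) := by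
  induction l with
  | zero => simp [traceNorm_zero]
  | succ l ih =>
    have e : v ^ (l + 1) * u - u * w ^ (l + 1)
        = v * (v ^ l * u - u * w ^ l) + (v * u - u * w) * w ^ l := by
      rw [pow_succ' v, pow_succ' w]
      noncomm_ring
    rw [e]
    refine (hτ.traceNorm_add_le _ _).trans ?_
    rw [traceNorm_unitary_mul τ hv, hτ.traceNorm_mul_unitary (pow_mem hw l)]
    push_cast
    linarith

lemma norm_map_star_mul_sub_le (hτ : IsTracialState τ) {a b a' b' : A} {δ : ℝ} (hδ1 : δ ≤ 1)
    (ha : a ∈ unitary A) (hb : b ∈ unitary A)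
    (haa : traceNorm τ (a' - a) ≤ δ) (hbb : traceNorm τ (b' - b) ≤ δ) :
    ‖τ (star a' * b') - τ (star a * b)‖ ≤ 3 * δ := by
  have hn : ∀ {c : A}, c ∈ unitary A → traceNorm τ c = 1 := fun hc => by
    simpa [hτ.traceNorm_one] using traceNorm_unitary_mul τ hc 1
  have e : τ (star a' * b') - τ (star a * b)
      = τ (star (a' - a) * b') + τ (star a * (b' - b)) := by
    rw [← map_sub, ← map_add]
    congr 1
    rw [star_sub]
    noncomm_ring
  rw [e]
  refine (norm_add_le _ _).trans ?_
  have h1 := hτ.norm_map_star_mul_le (a' - a) b'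
  have h2 := hτ.norm_map_star_mul_le a (b' - b)
  have h3 : traceNorm τ b' ≤ 1 + δ := by
    have := hτ.traceNorm_le_add b' b
    rw [hn hb] at this
    linarith
  rw [hn ha, one_mul] at h2
  have h0 : 0 ≤ δ := (traceNorm_nonneg _ _).trans haa
  have h4 : traceNorm τ (a' - a) * traceNorm τ b' ≤ δ * (1 + δ) :=
    mul_le_mul haa h3 (traceNorm_nonneg _ _) h0
  nlinarith

/-- If `u` almost intertwines Haar unitaries `v` and `w` whose powers are approximated by
`⋆`-polynomials in `x`, then `u` is almost fixed by the averages of `V_l(x) u W_l(x)⋆` with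
`V_l(x)` close to `v^l` and `W_l(x)` close to `w^l`. -/
lemma exists_averaging (hτ : IsTracialState τ) {n : ℕ} {x : Fin n → A} {u : A}
    (hu : u ∈ unitary A)
    (hvw : ∀ κ : ℝ, 0 < κ → ∃ v w : A, v ∈ unitary A ∧ w ∈ unitary A ∧
      (∀ m : ℕ, m ≠ 0 → τ (v ^ m) = 0 ∧ τ (star v ^ m) = 0) ∧
      (∀ m : ℕ, m ≠ 0 → τ (w ^ m) = 0 ∧ τ (star w ^ m) = 0) ∧
      traceNorm τ (v * u - u * w) < κ ∧
      (∀ (l : ℕ) (δ : ℝ), 0 < δ → ∃ P : NCPoly n, traceNorm τ (P.eval x - v ^ l) < δ) ∧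
      (∀ (l : ℕ) (δ : ℝ), 0 < δ → ∃ P : NCPoly n, traceNorm τ (P.eval x - w ^ l) < δ))
    (N : ℕ) (hN : 0 < N) (η : ℝ) (hη : 0 < η) (κ : ℝ) (hκ : 0 < κ) :
    ∃ V W : Fin N → NCPoly n,
      (∀ l l', ‖τ (star ((V l).eval x) * (V l').eval x) - if l = l' then 1 else 0‖ < η) ∧
      (∀ l l', ‖τ (star ((W l).eval x) * (W l').eval x) - if l = l' then 1 else 0‖ < η) ∧
      traceNorm τ ((NCPoly.averaging V W).eval (Fin.cons u x : Fin (n + 1) → A) - u) < κ := by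
  have hN' : (0 : ℝ) < N := by exact_mod_cast hN
  obtain ⟨v, w, hv, hw, hvm, hwm, hint, hvP, hwP⟩ := hvw (κ / (4 * N)) (by positivity)
  set δ : ℝ := min 1 (min (η / 4) (κ / 4))
  have hδ : 0 < δ := by positivity
  have hδ1 : δ ≤ 1 := min_le_left _ _
  have hδη : δ ≤ η / 4 := (min_le_right _ _).trans (min_le_left _ _)
  have hδκ : δ ≤ κ / 4 := (min_le_right _ _).trans (min_le_right _ _)
  choose W hW using fun l : Fin N => hwP l δ hδ
  -- The accuracy of `V` is chosen after the norms of the `W_l(x)` are known.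
  set K : ℝ := 1 + ∑ l, ‖(W l).eval x‖
  have hWK : ∀ l, ‖(W l).eval x‖ ≤ K := fun l =>
    (Finset.single_le_sum (fun l _ => norm_nonneg ((W l).eval x)) (Finset.mem_univ l)).trans
      (by linarith)
  have hK1 : 1 ≤ K := by
    have := Finset.sum_nonneg fun l (_ : l ∈ (Finset.univ : Finset (Fin N))) =>
      norm_nonneg ((W l).eval x)
    linarith
  have hK : 0 < K := by linarith
  choose V hV using fun l : Fin N => hvP l (δ / K) (by positivity)
  have hVδ : ∀ l, traceNorm τ ((V l).eval x - v ^ (l : ℕ)) ≤ δ := fun l =>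
    (hV l).le.trans (div_le_self hδ.le hK1)
  refine ⟨V, W, fun l l' => ?_, fun l l' => ?_, ?_⟩
  · have h := norm_map_star_mul_sub_le hτ hδ1 (pow_mem hv l) (pow_mem hv l') (hVδ l) (hVδ l')
    rw [map_star_pow_mul_pow hτ.map_one hv hvm] at h
    simp only [Fin.val_inj] at h
    linarith
  · have h := norm_map_star_mul_sub_le hτ hδ1 (pow_mem hw l) (pow_mem hw l') (hW l).le (hW l').le
    rw [map_star_pow_mul_pow hτ.map_one hw hwm] at h
    simp only [Fin.val_inj] at h
    linarith
  · have hterm : ∀ l : Fin N, traceNorm τ ((V l).eval x * u * star ((W l).eval x) - u)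
        ≤ 3 * (κ / 4) := by
      intro l
      have e : (V l).eval x * u * star ((W l).eval x) - u
          = ((V l).eval x - v ^ (l : ℕ)) * (u * star ((W l).eval x))
            + (v ^ (l : ℕ) * (u * star ((W l).eval x - w ^ (l : ℕ)))
            + (v ^ (l : ℕ) * u - u * w ^ (l : ℕ)) * star (w ^ (l : ℕ))) := by
        have e1 : w ^ (l : ℕ) * star (w ^ (l : ℕ)) = 1 :=
          Unitary.mul_star_self_of_mem (pow_mem hw l)
        rw [star_sub, sub_mul _ (u * w ^ (l : ℕ)), mul_assoc u (w ^ (l : ℕ)), e1]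
        noncomm_ring
      have h1 : traceNorm τ (((V l).eval x - v ^ (l : ℕ)) * (u * star ((W l).eval x)))
          ≤ κ / 4 := by
        refine (hτ.traceNorm_mul_le' _ _).trans ?_
        rw [CStarRing.norm_mem_unitary_mul _ hu, norm_star]
        calc _ ≤ δ / K * K := mul_le_mul (hV l).le (hWK l) (norm_nonneg _) (by positivity)
          _ = δ := by field_simp
          _ ≤ κ / 4 := hδκ
      have h2 : traceNorm τ (v ^ (l : ℕ) * (u * star ((W l).eval x - w ^ (l : ℕ)))) ≤ κ / 4 := by
        rw [traceNorm_unitary_mul τ (pow_mem hv l), traceNorm_unitary_mul τ hu, hτ.traceNorm_star]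
        exact (hW l).le.trans hδκ
      have h3 : traceNorm τ ((v ^ (l : ℕ) * u - u * w ^ (l : ℕ)) * star (w ^ (l : ℕ)))
          ≤ κ / 4 := by
        rw [hτ.traceNorm_mul_unitary (Unitary.star_mem (pow_mem hw l))]
        refine (traceNorm_pow_mul_sub_le hτ hv hw l).trans ?_
        have hl : (l : ℝ) ≤ N := by exact_mod_cast l.2.le
        calc _ ≤ (N : ℝ) * (κ / (4 * N)) :=
              mul_le_mul hl hint.le (traceNorm_nonneg _ _) hN'.le
          _ = κ / 4 := by field_simp
      rw [e]
      have h4 := hτ.traceNorm_add_le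
        (((V l).eval x - v ^ (l : ℕ)) * (u * star ((W l).eval x)))
        (v ^ (l : ℕ) * (u * star ((W l).eval x - w ^ (l : ℕ)))
            + (v ^ (l : ℕ) * u - u * w ^ (l : ℕ)) * star (w ^ (l : ℕ)))
      have h5 := hτ.traceNorm_add_le (v ^ (l : ℕ) * (u * star ((W l).eval x - w ^ (l : ℕ))))
        ((v ^ (l : ℕ) * u - u * w ^ (l : ℕ)) * star (w ^ (l : ℕ)))
      linarith
    have hNc : (N : ℂ) ≠ 0 := by exact_mod_cast hN.ne'
    have e : (NCPoly.averaging V W).eval (Fin.cons u x : Fin (n + 1) → A) - u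
        = (N : ℂ)⁻¹ • ∑ l, ((V l).eval x * u * star ((W l).eval x) - u) := by
      rw [NCPoly.eval_averaging, Finset.sum_sub_distrib, smul_sub]
      congr 1
      rw [Finset.sum_const, Finset.card_univ, Fintype.card_fin, ← Nat.cast_smul_eq_nsmul ℂ,
        smul_smul, inv_mul_cancel₀ hNc, one_smul]
    rw [e, traceNorm_smul, norm_inv, Complex.norm_natCast, inv_mul_lt_iff₀ hN']
    refine (hτ.traceNorm_sum_le _ _).trans_lt ?_
    calc _ ≤ ∑ _l : Fin N, 3 * (κ / 4) := Finset.sum_le_sum fun l _ => hterm l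
      _ = N * (3 * (κ / 4)) := by simp
      _ < N * κ := by gcongr; linarith

end Haar

/-! ### Passage to a von Neumann subalgebra -/

section Subalgebra

variable {H : Type*} [NormedAddCommGroup H] [InnerProductSpace ℂ H] [CompleteSpace H]
  {M N : VonNeumannAlgebra H}

/-- The inclusion of a von Neumann subalgebra. -/
abbrev inclusion (h : N ≤ M) : N.toStarSubalgebra →⋆ₐ[ℂ] M.toStarSubalgebra :=
  StarSubalgebra.inclusion (S₁ := N.toStarSubalgebra) (S₂ := M.toStarSubalgebra) h

lemma restrict_apply (h : N ≤ M) (τ : M.toStarSubalgebra →ₗ[ℂ] ℂ) (a : N.toStarSubalgebra) :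
    restrict h τ a = τ (inclusion h a) := rfl

lemma IsNormalTracialState.restrict {τ : M.toStarSubalgebra →ₗ[ℂ] ℂ}
    (hτ : IsNormalTracialState M τ) (h : N ≤ M) : IsNormalTracialState N (restrict h τ) where
  map_one := by rw [restrict_apply, _root_.map_one (inclusion h), hτ.map_one]
  nonneg a := by
    rw [restrict_apply, map_mul, map_star]
    exact hτ.nonneg _
  tracial a b := by
    rw [restrict_apply, restrict_apply, map_mul (inclusion h), map_mul (inclusion h), hτ.tracial]
  normal := by
    obtain ⟨ξ, h1, h2⟩ := hτ.normal
    exact ⟨ξ, h1, fun a => h2 (inclusion h a)⟩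

lemma traceNorm_restrict (h : N ≤ M) (τ : M.toStarSubalgebra →ₗ[ℂ] ℂ) (a : N.toStarSubalgebra) :
    traceNorm (restrict h τ) a = traceNorm τ (inclusion h a) := by
  rw [traceNorm, traceNorm, restrict_apply, map_mul, map_star]

/-- The upper free orbit-dimension of a tuple does not depend on the ambient algebra. -/
lemma upperOrbitDimTuple_restrict (h : N ≤ M) (τ : M.toStarSubalgebra →ₗ[ℂ] ℂ) {n : ℕ}
    (x : Fin n → N.toStarSubalgebra) :
    upperOrbitDimTuple τ (fun i => inclusion h (x i)) = upperOrbitDimTuple (restrict h τ) x := by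
  have e : ∀ w, τ (wordEval (fun i => inclusion h (x i)) w) = restrict h τ (wordEval x w) := by
    intro w
    rw [restrict_apply, ← NCPoly.eval_ofWord, ← NCPoly.eval_ofWord, NCPoly.map_eval]
  have e' : ∀ R m k ε, microstates τ (fun i => inclusion h (x i)) R m k ε
      = microstates (restrict h τ) x R m k ε := by
    intro R m k ε
    simp only [microstates, e]
  simp only [upperOrbitDimTuple, orbitDimAt, orbitDimAtRadius, e']

/-- Adjoining `u` to a generating tuple of `N` gives a generating tuple of the von Neumann algebra
generated by `N` and `u`. -/
lemma generates_cons (h : N ≤ M) {u : M.toStarSubalgebra}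
    (hgen : Generates ((N : Set (H →L[ℂ] H)) ∪ {(u : H →L[ℂ] H)}) M) {n : ℕ}
    {x : Fin n → N.toStarSubalgebra}
    (hx : Generates (Set.range fun i => (x i : H →L[ℂ] H)) N) :
    Generates (Set.range fun i : Fin (n + 1) =>
      ((Fin.cons u (fun i => inclusion h (x i)) : Fin (n + 1) → M.toStarSubalgebra) i :
        H →L[ℂ] H)) M := by
  have hrange : (Set.range fun i : Fin (n + 1) =>
      ((Fin.cons u (fun i => inclusion h (x i)) : Fin (n + 1) → M.toStarSubalgebra) i :
        H →L[ℂ] H)) = (Set.range fun i => (x i : H →L[ℂ] H)) ∪ {(u : H →L[ℂ] H)} := by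
    ext a
    simp only [Set.mem_range, Fin.exists_fin_succ, Fin.cons_zero, Fin.cons_succ, Set.union_singleton,
      Set.mem_insert_iff]
    exact or_congr eq_comm Iff.rfl
  have hstarN : star (N : Set (H →L[ℂ] H)) = N := by
    ext a
    exact ⟨fun ha => by simpa using N.toStarSubalgebra.star_mem' ha,
      fun ha => N.toStarSubalgebra.star_mem' ha⟩
  unfold Generates at hx hgen ⊢
  have hN : Set.centralizer (N : Set (H →L[ℂ] H)) = Set.centralizer
      ((Set.range fun i => (x i : H →L[ℂ] H)) ∪ star (Set.range fun i => (x i : H →L[ℂ] H))) := by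
    rw [← hx, Set.centralizer_centralizer_centralizer]
  rw [← hgen, hrange]
  congr 1
  simp only [Set.union_star, Set.centralizer_union, hstarN, hN]
  ext a
  simp only [Set.mem_inter_iff]
  tauto

/-- If a unitary `u` almost intertwines Haar unitaries of `N`, then `𝔎₂(N) = 0` passes to the von
Neumann algebra generated by `N` and `u`. -/
theorem upperOrbitDim_eq_zero (h : N ≤ M) {τ : M.toStarSubalgebra →ₗ[ℂ] ℂ}
    (hτ : IsNormalTracialState M τ) (hK : upperOrbitDim N (FreeOrbit.restrict h τ) = 0)
    {u : M.toStarSubalgebra} (hu : u ∈ unitary M.toStarSubalgebra)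
    (hgen : Generates ((N : Set (H →L[ℂ] H)) ∪ {(u : H →L[ℂ] H)}) M)
    (hvw : ∀ κ : ℝ, 0 < κ → ∃ v w : M.toStarSubalgebra,
      ((v : H →L[ℂ] H) ∈ N ∧ IsHaarUnitary τ v) ∧ ((w : H →L[ℂ] H) ∈ N ∧ IsHaarUnitary τ w) ∧
      norm2 τ (v * u - u * w) < κ) : upperOrbitDim M τ = 0 := by
  have : IsClosed (M.toStarSubalgebra : Set (H →L[ℂ] H)) := isClosed_vonNeumannAlgebra M
  -- A generating tuple of `N` exists because the supremum `𝔎₂(N)` is not `⊥`.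
  obtain ⟨n, x, hx⟩ : ∃ (n : ℕ) (x : Fin n → N.toStarSubalgebra),
      Generates (Set.range fun i => (x i : H →L[ℂ] H)) N := by
    by_contra! hno
    have hbot : upperOrbitDim N (FreeOrbit.restrict h τ) = ⊥ := by
      simp only [upperOrbitDim, iSup_eq_bot]
      exact fun n x hx => absurd hx (hno n x)
    rw [hK] at hbot
    exact EReal.zero_ne_bot hbot
  have hx0 : upperOrbitDimTuple τ (fun i => inclusion h (x i)) ≤ 0 := by
    rw [upperOrbitDimTuple_restrict, ← hK]
    exact le_iSup_of_le n (le_iSup_of_le x (le_iSup_of_le hx le_rfl))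
  have hgen' := generates_cons h hgen hx
  have hdense := hτ.isTraceDense hgen'
  have hdenseN := (hτ.restrict h).isTraceDense hx
  have hpow : ∀ v : M.toStarSubalgebra, (v : H →L[ℂ] H) ∈ N → ∀ (l : ℕ) (δ : ℝ), 0 < δ →
      ∃ P : NCPoly n, traceNorm τ (P.eval (fun i => inclusion h (x i)) - v ^ l) < δ := by
    intro v hv l δ hδ
    obtain ⟨P, hP⟩ := hdenseN ((⟨v, hv⟩ : N.toStarSubalgebra) ^ l) δ hδ
    refine ⟨P, ?_⟩
    rw [traceNorm_restrict, map_sub, map_pow, NCPoly.map_eval] at hP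
    exact hP
  have havg := exists_averaging hτ.isTracialState hu (x := fun i => inclusion h (x i))
    (fun κ hκ => by
      obtain ⟨v, w, ⟨hv1, hv2⟩, ⟨hw1, hw2⟩, hvw'⟩ := hvw κ hκ
      exact ⟨v, w, hv2.1, hw2.1, hv2.2, hw2.2, hvw', hpow v hv1, hpow w hw1⟩)
  refine le_antisymm (iSup_le fun p => iSup_le fun y => iSup_le fun hy => ?_) ?_
  · exact upperOrbitDimTuple_le_zero_of_averaging hτ.isTracialState hx0 (hτ.isTraceDense hy) hdense
      havg
  · exact le_iSup_of_le (n + 1) (le_iSup_of_le _ (le_iSup_of_le hgen'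
      (upperOrbitDimTuple_nonneg _ _)))

end Subalgebra

end FreeOrbit

end

theorem theorem4 {H : Type*} [NormedAddCommGroup H] [InnerProductSpace ℂ H] [CompleteSpace H]
    (M N : VonNeumannAlgebra H) (hNM : N ≤ M)
    (τ : M.toStarSubalgebra →ₗ[ℂ] ℂ) (hτ : FreeOrbit.IsNormalTracialState M τ)
    (hM : FreeOrbit.IsDiffuse M) (hN : FreeOrbit.IsDiffuse N)
    (hK : FreeOrbit.upperOrbitDim N (FreeOrbit.restrict hNM τ) = 0)
    (u : M.toStarSubalgebra) (hu : u ∈ unitary M.toStarSubalgebra)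
    (hgen : FreeOrbit.Generates ((N : Set (H →L[ℂ] H)) ∪ {(u : H →L[ℂ] H)}) M) :
    ((∃ v w : ℕ → M.toStarSubalgebra,
        (∀ n, (v n : H →L[ℂ] H) ∈ N ∧ FreeOrbit.IsHaarUnitary τ (v n)) ∧
        (∀ n, (w n : H →L[ℂ] H) ∈ N ∧ FreeOrbit.IsHaarUnitary τ (w n)) ∧
        Filter.Tendsto (fun n => FreeOrbit.norm2 τ (v n * u - u * w n)) Filter.atTop (nhds 0)) →
      FreeOrbit.upperOrbitDim M τ = 0) ∧
    ((∃ v w : M.toStarSubalgebra,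
        ((v : H →L[ℂ] H) ∈ N ∧ FreeOrbit.IsHaarUnitary τ v) ∧
        ((w : H →L[ℂ] H) ∈ N ∧ FreeOrbit.IsHaarUnitary τ w) ∧
        v * u = u * w) →
      FreeOrbit.upperOrbitDim M τ = 0) := by
  constructor
  · rintro ⟨v, w, hv, hw, hlim⟩
    refine FreeOrbit.upperOrbitDim_eq_zero hNM hτ hK hu hgen fun κ hκ => ?_
    obtain ⟨n, hn⟩ := (hlim.eventually_lt_const hκ).exists
    exact ⟨v n, w n, hv n, hw n, hn⟩
  · rintro ⟨v, w, hv, hw, hvw⟩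
    refine FreeOrbit.upperOrbitDim_eq_zero hNM hτ hK hu hgen fun κ hκ => ⟨v, w, hv, hw, ?_⟩
    simpa [hvw, FreeOrbit.norm2] using hκ
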